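/- Let $\mathcal A_0=\bigoplus_{\alpha\in I}M_{n_\alpha}(\mathbb C)$ (algebraic direct sum, $n_\alpha\ge 1$, $I$ any index set) be a discrete quantum group: write $\mathcal M(\mathcal A_0)$, $\mathcal M(\mathcal A_0\otimes\mathcal A_0)$ for the C*-algebras of bounded families in $\prod_\alpha M_{n_\alpha}$, $\prod_{\alpha,\beta}M_{n_\alpha}\otimes M_{n_\beta}$; there is given a unital $*$-homomorphism $\Delta:\mathcal M(\mathcal A_0)\to\mathcal M(\mathcal A_0\otimes\mathcal A_0)$ such that $T_1(a\otimes b)=\Delta(a)(1\otimes b)$ and $T_2(a\otimes b)=(a\otimes 1)\Delta(b)$ define linear bijections of the algebraic tensor product $\mathcal A_0\otimes\mathcal A_0$ onto itself, and $(a\otimes1\otimes1)(\Delta\otimes \mathrm{id})(\Delta(b)(1\otimes c))=(\mathrm{id}\otimes\Delta)((a\otimes1)\Delta(b))(1\otimes1\otimes c)$ for $a,b,c\in\mathcal A_0$. Let $\epsilon$ and $S:\mathcal A_0\to\mathcal A_0$ be its counit and antipode. Let $\phi$ be a positive faithful left invariant linear functional on $\mathcal A_0$, i.e. $(\mathrm{id}\otimes\phi)((b\otimes1)\Delta(a))=\phi(a)b$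 for all $a,b\in\mathcal A_0$. Let $\theta=(\theta_\alpha)$ be the positive square root of the modular element of $\phi$, i.e. each $\theta_\alpha\in M_{n_\alpha}$ is positive definite and $\phi(S(a))=\phi(a\theta^2)$ for $a\in\mathcal A_0$; let $\psi(a)=\phi(a\theta^2)$ be the corresponding right Haar functional. Let $\mathcal A_0'$ be the space of linear functionals on $\mathcal A_0$ vanishing on all but finitely many $M_{n_\alpha}$; for $f,g\in\mathcal A_0'$ put $(f*g)(x)=(f\otimes g)(\Delta(x))$ and $f^*(x)=\overline{f(S(x)^*)}$, $x\in\mathcal A_0$. For $a\in\mathcal A_0$ let $\psi_a\in\mathcal A_0'$ be $\psi_a(x)=\psi(ax)$. Then for all $a,b\in\mathcal A_0$: (1) $(\mathrm{id}\otimes\psi)\big((1\otimes b)\,(\mathrm{id}\otimes S^{-1})(\Delta(a))\big)=(\phi\otimes\mathrm{id})\big((a\otimes1)\,(S\otimes\mathrm{id})(\Delta(b))\big)$; denote this element of $\mathcal A_0$ by $a*b$; (2) $\psi_a*\psi_b=\psi_{a*b}$; (3) $\psi_a^*=\psi_{a^\sharp}$, where $a^\sharp=\theta^{-2}S^{-1}(a^*)$.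 Moreover $a\mapsto\psi_a$ is injective, and the vector space $\mathcal A_0$ with the product $(a,b)\mapsto a*b$ and the involution $a\mapsto a^\sharp$ is an associative $*$-algebra $\hat{\mathcal A}_0$: $*$ is bilinear and associative, $\sharp$ is conjugate-linear, $(a*b)^\sharp=b^\sharp*a^\sharp$ and $(a^\sharp)^\sharp=a$. -/

import Mathlib

open scoped TensorProduct ComplexOrder

noncomputable section

namespace DQG

universe u

/-- Algebraic multipliers of `⊕ M_{n α}`: arbitrary families of matrices, with the
componentwise `*`-algebra structure. -/
abbrev Malg {I : Type u} (n : I → ℕ) : Type u :=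
  (α : I) → Matrix (Fin (n α)) (Fin (n α)) ℂ

/-- Algebraic multipliers of the tensor square: arbitrary families with `(α, β)` component in
`M_{n α} ⊗ M_{n β}`, realised as matrices over `Fin (n α) × Fin (n β)` (Kronecker products). -/
abbrev Malg₂ {I : Type u} (n : I → ℕ) : Type u :=
  (p : I × I) → Matrix (Fin (n p.1) × Fin (n p.2)) (Fin (n p.1) × Fin (n p.2)) ℂ

section Bounded

open scoped Matrix.Norms.L2Operator

/-- The bounded families of matrices, for the C*-norm (operator norm) on each block. -/
def boundedFamilies {J : Type u} (κ : J → Type) [∀ j, Fintype (κ j)] [∀ j, DecidableEq (κ j)] :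
    StarSubalgebra ℂ ((j : J) → Matrix (κ j) (κ j) ℂ) where
  carrier := {a | ∃ C : ℝ, ∀ j, ‖a j‖ ≤ C}
  mul_mem' := by
    rintro a b ⟨C, hC⟩ ⟨D, hD⟩
    refine ⟨C * D, fun j => (norm_mul_le (a j) (b j)).trans ?_⟩
    exact mul_le_mul (hC j) (hD j) (norm_nonneg _) ((norm_nonneg _).trans (hC j))
  add_mem' := by
    rintro a b ⟨C, hC⟩ ⟨D, hD⟩
    exact ⟨C + D, fun j => (norm_add_le (a j) (b j)).trans (add_le_add (hC j) (hD j))⟩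
  algebraMap_mem' := by
    intro r
    refine ⟨‖r‖, fun j => ?_⟩
    have h1 : ‖(1 : Matrix (κ j) (κ j) ℂ)‖ ≤ 1 := by
      have h := CStarRing.norm_star_mul_self (x := (1 : Matrix (κ j) (κ j) ℂ))
      rw [star_one, one_mul] at h
      nlinarith [norm_nonneg (1 : Matrix (κ j) (κ j) ℂ)]
    have h2 : (algebraMap ℂ ((j : J) → Matrix (κ j) (κ j) ℂ) r) j
        = r • (1 : Matrix (κ j) (κ j) ℂ) := by
      rw [Pi.algebraMap_apply, Algebra.algebraMap_eq_smul_one]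
    rw [h2, norm_smul]
    exact mul_le_of_le_one_right (norm_nonneg r) h1
  star_mem' := by
    rintro a ⟨C, hC⟩
    exact ⟨C, fun j => by rw [Pi.star_apply, norm_star]; exact hC j⟩

end Bounded

variable {I : Type u} {n : I → ℕ}

/-- The unital C*-algebra `M(A₀)` of bounded families `(a_α)`. -/
abbrev Mbdd (n : I → ℕ) : StarSubalgebra ℂ (Malg n) :=
  boundedFamilies (fun α => Fin (n α))

/-- The unital C*-algebra `M(A₀ ⊗ A₀)` of bounded families `(m_{αβ})`. -/
abbrev Mbdd₂ (n : I → ℕ) : StarSubalgebra ℂ (Malg₂ n) :=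
  boundedFamilies (fun p : I × I => Fin (n p.1) × Fin (n p.2))

/-- `A₀`, the algebraic direct sum of the matrix algebras `M_{n α}`, as the `*`-algebra of
finitely supported families. -/
def A₀ (n : I → ℕ) : NonUnitalStarSubalgebra ℂ (Malg n) where
  carrier := {a | {α | a α ≠ 0}.Finite}
  add_mem' := by
    intro a b ha hb
    refine (ha.union hb).subset fun α h => ?_
    by_contra h'
    simp only [Set.mem_union, Set.mem_ofPred_eq, not_or, not_not] at h'
    exact h (by simp [h'.1, h'.2])
  zero_mem' := by simp
  mul_mem' := by
    intro a b ha hb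
    refine ha.subset fun α h h' => h ?_
    simp [h']
  smul_mem' := by
    intro c a ha
    refine ha.subset fun α h h' => h ?_
    simp [h']
  star_mem' := by
    intro a ha
    refine ha.subset fun α h h' => h ?_
    simp [h']

theorem A₀_le_Mbdd (a : A₀ n) : (a : Malg n) ∈ Mbdd n := by
  classical
  have hfin : {α | (a : Malg n) α ≠ 0}.Finite := a.2
  let _ : ∀ α : I, NormedAddCommGroup (Matrix (Fin (n α)) (Fin (n α)) ℂ) :=
    fun _ => Matrix.instL2OpNormedAddCommGroup
  refine ⟨∑ α ∈ hfin.toFinset, ‖(a : Malg n) α‖, fun α => ?_⟩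
  by_cases h : (a : Malg n) α = 0
  · rw [h]
    exact (norm_zero (E := Matrix (Fin (n α)) (Fin (n α)) ℂ)).le.trans
      (Finset.sum_nonneg fun β _ => norm_nonneg ((a : Malg n) β))
  · exact Finset.single_le_sum (f := fun β => ‖(a : Malg n) β‖)
      (fun β _ => norm_nonneg ((a : Malg n) β)) (hfin.mem_toFinset.2 h)

/-- The inclusion of `A₀` in `M(A₀)`. -/
def toMbdd (a : A₀ n) : Mbdd n := ⟨a, A₀_le_Mbdd a⟩

open Classical in
/-- `M_{n α}` as a summand of `A₀`. -/
def single (α : I) (M : Matrix (Fin (n α)) (Fin (n α)) ℂ) : A₀ n :=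
  ⟨Pi.single α M, by
    refine (Set.finite_singleton α).subset fun β h => ?_
    by_contra h'
    exact h (Pi.single_eq_of_ne (M := fun γ => Matrix (Fin (n γ)) (Fin (n γ)) ℂ) h' M)⟩

/-- The matrix unit `e^α_{ij}`. -/
def matrixUnit (n : I → ℕ) (α : I) (i j : Fin (n α)) : A₀ n :=
  single α (Matrix.single i j 1)

/-- The map `x ↦ a x` on `A₀`, for an algebraic multiplier `a`. -/
def multLeft (a : Malg n) : A₀ n →ₗ[ℂ] A₀ n where
  toFun x := ⟨a * x, by
    have hx : {α | (x : Malg n) α ≠ 0}.Finite := x.2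
    refine hx.subset fun α h h' => h ?_
    simp [h']⟩
  map_add' x y := Subtype.ext (mul_add a (x : Malg n) y)
  map_smul' c x := Subtype.ext (mul_smul_comm c a (x : Malg n))

/-- The map `x ↦ x a` on `A₀`, for an algebraic multiplier `a`. -/
def multRight (a : Malg n) : A₀ n →ₗ[ℂ] A₀ n where
  toFun x := ⟨x * a, by
    have hx : {α | (x : Malg n) α ≠ 0}.Finite := x.2
    refine hx.subset fun α h h' => h ?_
    simp [h']⟩
  map_add' x y := Subtype.ext (add_mul (x : Malg n) y a)
  map_smul' c x := Subtype.ext (smul_mul_assoc c (x : Malg n) a)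

/-- The elementary tensor `a ⊗ b` of algebraic multipliers, as a bilinear map. -/
def kron (n : I → ℕ) : Malg n →ₗ[ℂ] Malg n →ₗ[ℂ] Malg₂ n :=
  LinearMap.mk₂ ℂ (fun a b p => Matrix.kronecker (a p.1) (b p.2))
    (fun a a' b => funext fun p => Matrix.add_kronecker (a p.1) (a' p.1) (b p.2))
    (fun c a b => funext fun p => Matrix.smul_kronecker c (a p.1) (b p.2))
    (fun a b b' => funext fun p => Matrix.kronecker_add (a p.1) (b p.2) (b' p.2))
    (fun c a b => funext fun p => Matrix.kronecker_smul c (a p.1) (b p.2))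

/-- The inclusion of the algebraic tensor product `A₀ ⊗ A₀` in its algebraic multipliers. -/
def tensorIncl (n : I → ℕ) : A₀ n ⊗[ℂ] A₀ n →ₗ[ℂ] Malg₂ n :=
  TensorProduct.lift
    ((kron n).compl₁₂ (A₀ n).toNonUnitalSubalgebra.toSubmodule.subtype
      (A₀ n).toNonUnitalSubalgebra.toSubmodule.subtype)

/-- The component `X_{αβ} ∈ M_{n α} ⊗ M_{n β}` of an algebraic multiplier `X` of `A₀ ⊗ A₀`,
as an element of `A₀ ⊗ A₀`. -/
def component (X : Malg₂ n) (p : I × I) : A₀ n ⊗[ℂ] A₀ n :=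
  ∑ i, ∑ j, ∑ k, ∑ l, X p (i, k) (j, l) • (matrixUnit n p.1 i j ⊗ₜ[ℂ] matrixUnit n p.2 k l)

/-- The value `F(X) = ∑_{α,β} F(X_{αβ})` of a linear map `F` on `A₀ ⊗ A₀` at an algebraic
multiplier `X` for which only finitely many `F(X_{αβ})` are nonzero. -/
def evalMult {V : Type*} [AddCommGroup V] [Module ℂ V]
    (F : A₀ n ⊗[ℂ] A₀ n →ₗ[ℂ] V) (X : Malg₂ n) : V :=
  ∑ᶠ p : I × I, F (component X p)

/-- `A₀'`, the linear functionals on `A₀` that vanish on all but finitely many `M_{n α}`. -/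
def finSuppDual (n : I → ℕ) : Submodule ℂ (A₀ n →ₗ[ℂ] ℂ) where
  carrier := {f | {α | ∃ M, f (single α M) ≠ 0}.Finite}
  add_mem' := by
    intro f g hf hg
    refine (hf.union hg).subset ?_
    rintro α ⟨M, hM⟩
    by_contra h'
    simp only [Set.mem_union, Set.mem_ofPred_eq, not_or, not_exists, not_not] at h'
    exact hM (by simp [h'.1 M, h'.2 M])
  zero_mem' := by simp
  smul_mem' := by
    intro c f hf
    refine hf.subset ?_
    rintro α ⟨M, hM⟩
    exact ⟨M, fun h => hM (by simp [h])⟩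

/-- For a functional `ψ` on `A₀` and `a ∈ A₀`, the finitely supported functional
`ψ_a = ψ(a ·)`. -/
def leftTranslate (ψ : A₀ n →ₗ[ℂ] ℂ) (a : A₀ n) : finSuppDual n :=
  ⟨ψ ∘ₗ LinearMap.mulLeft ℂ a, by
    have ha : {α | (a : Malg n) α ≠ 0}.Finite := a.2
    refine ha.subset ?_
    rintro α ⟨M, hM⟩ h
    refine hM ?_
    have h0 : a * single α M = 0 := by
      refine Subtype.ext (funext fun β => ?_)
      classical
      change (a : Malg n) β * (Pi.single α M : Malg n) β = 0
      by_cases hβ : β = α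
      · subst hβ
        rw [h, zero_mul]
      · rw [Pi.single_eq_of_ne hβ, mul_zero]
    simp [h0]⟩

end DQG

open DQG

/-- A discrete quantum group `A₀ = ⊕_α M_{n α}`: a unital `*`-homomorphism
`Δ : M(A₀) → M(A₀ ⊗ A₀)` such that `T₁(a ⊗ b) = Δ(a)(1 ⊗ b)` and `T₂(a ⊗ b) = (a ⊗ 1)Δ(b)` define
linear bijections of the algebraic tensor product `A₀ ⊗ A₀` (the fields `T₁`, `T₂` are
determined by `Δ`), and such that `Δ` is coassociative. -/
structure DiscreteQuantumGroup (I : Type*) (n : I → ℕ) where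
  n_pos : ∀ α, 0 < n α
  Δ : Mbdd n →⋆ₐ[ℂ] Mbdd₂ n
  T₁ : A₀ n ⊗[ℂ] A₀ n ≃ₗ[ℂ] A₀ n ⊗[ℂ] A₀ n
  T₂ : A₀ n ⊗[ℂ] A₀ n ≃ₗ[ℂ] A₀ n ⊗[ℂ] A₀ n
  T₁_spec : ∀ a b : A₀ n,
    tensorIncl n (T₁ (a ⊗ₜ b)) = (Δ (toMbdd a) : Malg₂ n) * kron n 1 b
  T₂_spec : ∀ a b : A₀ n,
    tensorIncl n (T₂ (a ⊗ₜ b)) = kron n a 1 * (Δ (toMbdd b) : Malg₂ n)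
  /-- `(a ⊗ 1 ⊗ 1)(Δ ⊗ id)(Δ(b)(1 ⊗ c)) = (id ⊗ Δ)((a ⊗ 1)Δ(b))(1 ⊗ 1 ⊗ c)`, where
  `(a ⊗ 1 ⊗ 1)(Δ ⊗ id)(x ⊗ y) = T₂(a ⊗ x) ⊗ y` and
  `(id ⊗ Δ)(x ⊗ y)(1 ⊗ 1 ⊗ c) = x ⊗ T₁(y ⊗ c)`. -/
  coassoc : ∀ a b c : A₀ n,
    T₂.toLinearMap.rTensor (A₀ n)
        ((TensorProduct.assoc ℂ (A₀ n) (A₀ n) (A₀ n)).symm (a ⊗ₜ T₁ (b ⊗ₜ c)))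
      = (TensorProduct.assoc ℂ (A₀ n) (A₀ n) (A₀ n)).symm
          (T₁.toLinearMap.lTensor (A₀ n)
            (TensorProduct.assoc ℂ (A₀ n) (A₀ n) (A₀ n) (T₂ (a ⊗ₜ b) ⊗ₜ c)))

namespace DiscreteQuantumGroup

universe u

variable {I : Type u} {n : I → ℕ} (D : DiscreteQuantumGroup I n)

/-- `Δ(a)` for `a ∈ A₀`, as an algebraic multiplier of `A₀ ⊗ A₀`. -/
def comul (a : A₀ n) : Malg₂ n := (D.Δ (toMbdd a) : Malg₂ n)

/-- `(ε ⊗ id)(Δ(a)(1 ⊗ b)) = ab` and `(id ⊗ ε)((a ⊗ 1)Δ(b)) = ab`. -/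
def IsCounit (ε : A₀ n →ₗ[ℂ] ℂ) : Prop :=
  (∀ a b : A₀ n, TensorProduct.lid ℂ (A₀ n) (ε.rTensor (A₀ n) (D.T₁ (a ⊗ₜ b))) = a * b) ∧
  (∀ a b : A₀ n, TensorProduct.rid ℂ (A₀ n) (ε.lTensor (A₀ n) (D.T₂ (a ⊗ₜ b))) = a * b)

open Classical in
/-- The counit (the unique functional satisfying `IsCounit`). -/
def counit : A₀ n →ₗ[ℂ] ℂ :=
  if h : ∃ ε : A₀ n →ₗ[ℂ] ℂ, D.IsCounit ε then h.choose else 0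

/-- With `m` the multiplication of `A₀`, `m((S ⊗ id)(Δ(a)(1 ⊗ b))) = ε(a)b` and
`m((id ⊗ S)((a ⊗ 1)Δ(b))) = ε(b)a`. -/
def IsAntipode (S : A₀ n ≃ₗ[ℂ] A₀ n) : Prop :=
  (∀ a b : A₀ n, LinearMap.mul' ℂ (A₀ n) (S.toLinearMap.rTensor (A₀ n) (D.T₁ (a ⊗ₜ b)))
    = D.counit a • b) ∧
  (∀ a b : A₀ n, LinearMap.mul' ℂ (A₀ n) (S.toLinearMap.lTensor (A₀ n) (D.T₂ (a ⊗ₜ b)))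
    = D.counit b • a)

open Classical in
/-- The antipode `S` (the unique map satisfying `IsAntipode`); `S⁻¹` is `D.antipode.symm`. -/
def antipode : A₀ n ≃ₗ[ℂ] A₀ n :=
  if h : ∃ S : A₀ n ≃ₗ[ℂ] A₀ n, D.IsAntipode S then h.choose else LinearEquiv.refl ℂ (A₀ n)

/-- `φ` is a left Haar functional: positive, faithful, and left invariant, that is
`(id ⊗ φ)((b ⊗ 1)Δ(a)) = φ(a)b`. -/
structure IsLeftHaar (φ : A₀ n →ₗ[ℂ] ℂ) : Prop where
  positive : ∀ a : A₀ n, 0 ≤ φ (star a * a)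
  faithful : ∀ a : A₀ n, φ (star a * a) = 0 → a = 0
  left_invariant : ∀ a b : A₀ n,
    TensorProduct.rid ℂ (A₀ n) (φ.lTensor (A₀ n) (D.T₂ (b ⊗ₜ a))) = φ a • b

/-- `θ` is the positive square root of the modular element `δ` of `φ`, which is given by
`φ(S(a)) = φ(aδ)`. -/
structure IsModularRoot (φ : A₀ n →ₗ[ℂ] ℂ) (θ : Malg n) : Prop where
  posDef : ∀ α, (θ α).PosDef
  modular : ∀ a : A₀ n, φ (D.antipode a) = φ (multRight (θ * θ) a)

/-- The right Haar functional `ψ(a) = φ(aθ²)`. -/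
def rightHaar (φ : A₀ n →ₗ[ℂ] ℂ) (θ : Malg n) : A₀ n →ₗ[ℂ] ℂ :=
  φ ∘ₗ multRight (θ * θ)

/-- The convolution `(f ∗ g)(x) = (f ⊗ g)(Δ(x))` of finitely supported functionals. -/
def conv (f g : finSuppDual n) (x : A₀ n) : ℂ :=
  evalMult (LinearMap.mul' ℂ ℂ ∘ₗ TensorProduct.map f.1 g.1) (D.comul x)

/-- The adjoint `f*(x) = conj (f(S(x)*))`. -/
def adjoint (f : finSuppDual n) (x : A₀ n) : ℂ :=
  star (f.1 (star (D.antipode x)))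

/-- `a ∗ b = (id ⊗ ψ)((1 ⊗ b)((id ⊗ S⁻¹)(Δ(a))))`. -/
def prod (ψ : A₀ n →ₗ[ℂ] ℂ) (a b : A₀ n) : A₀ n :=
  evalMult
    ((TensorProduct.rid ℂ (A₀ n)).toLinearMap
      ∘ₗ TensorProduct.map LinearMap.id ψ
      ∘ₗ TensorProduct.map LinearMap.id (LinearMap.mulLeft ℂ b)
      ∘ₗ TensorProduct.map LinearMap.id D.antipode.symm.toLinearMap)
    (D.comul a)

/-- `(φ ⊗ id)((a ⊗ 1)((S ⊗ id)(Δ(b))))`. -/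
def prod' (φ : A₀ n →ₗ[ℂ] ℂ) (a b : A₀ n) : A₀ n :=
  evalMult
    ((TensorProduct.lid ℂ (A₀ n)).toLinearMap
      ∘ₗ TensorProduct.map φ LinearMap.id
      ∘ₗ TensorProduct.map (LinearMap.mulLeft ℂ a) LinearMap.id
      ∘ₗ TensorProduct.map D.antipode.toLinearMap LinearMap.id)
    (D.comul b)

/-- `a^♯ = θ⁻² S⁻¹(a*)`. -/
def sharp (θ : Malg n) (a : A₀ n) : A₀ n :=
  multLeft (fun α => (θ α)⁻¹ * (θ α)⁻¹) (D.antipode.symm (star a))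

end DiscreteQuantumGroup

/-- The complex vector space `V` with the product `mul` and the involution `inv` is an
associative (not necessarily unital) `*`-algebra. -/
structure IsComplexStarAlgebra {V : Type*} [AddCommGroup V] [Module ℂ V]
    (mul : V → V → V) (inv : V → V) : Prop where
  add_mul : ∀ a b c, mul (a + b) c = mul a c + mul b c
  mul_add : ∀ a b c, mul a (b + c) = mul a b + mul a c
  smul_mul : ∀ (r : ℂ) a b, mul (r • a) b = r • mul a b
  mul_smul : ∀ (r : ℂ) a b, mul a (r • b) = r • mul a b
  mul_assoc : ∀ a b c, mul (mul a b) c = mul a (mul b c)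
  inv_add : ∀ a b, inv (a + b) = inv a + inv b
  inv_smul : ∀ (r : ℂ) a, inv (r • a) = star r • inv a
  inv_mul : ∀ a b, inv (mul a b) = mul (inv b) (inv a)
  inv_inv : ∀ a, inv (inv a) = a

end

open DQG

/-!
The space `A₀'` of finitely supported functionals is a `*`-algebra under `f ∗ g = (f ⊗ g)Δ` and
`f* = conj (f (S(·)*))`: associativity is the coassociativity of `Δ`, in the form that the two
actions `(id ⊗ f)Δ` and `(f ⊗ id)Δ` of `A₀'` on `A₀` commute, and `*` reverses products because `S`
reverses both the product and the coproduct. The map `a ↦ ψ_a` is injective because `φ` is faithful,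
so it remains to see that its range is closed under both operations, with the stated formulas.

For the product this is strong left invariance,
`S((id ⊗ φ)(Δ(a)(1 ⊗ c))) = (id ⊗ φ)((1 ⊗ a)Δ(c))`, which also shows that `S` exists. For the
involution one needs `φ(θ² a) = φ(a θ²)`, which amounts to `φ ∘ S² = φ`. Applying strong left
invariance to a cointegral of the discrete quantum group gives the stronger identity
`φ(b S²(a)) = φ(a b)`.
-/

theorem IsComplexStarAlgebra.of_injective {V W : Type*} [AddCommGroup V] [Module ℂ V]
    [AddCommGroup W] [Module ℂ W] {mulV : V → V → V} {invV : V → V} {mulW : W → W → W}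
    {invW : W → W} (hW : IsComplexStarAlgebra mulW invW) (Φ : V →ₗ[ℂ] W)
    (hΦ : Function.Injective Φ) (hmul : ∀ a b, Φ (mulV a b) = mulW (Φ a) (Φ b))
    (hinv : ∀ a, Φ (invV a) = invW (Φ a)) : IsComplexStarAlgebra mulV invV where
  add_mul a b c := hΦ (by simp only [hmul, map_add, hW.add_mul])
  mul_add a b c := hΦ (by simp only [hmul, map_add, hW.mul_add])
  smul_mul r a b := hΦ (by simp only [hmul, map_smul, hW.smul_mul])
  mul_smul r a b := hΦ (by simp only [hmul, map_smul, hW.mul_smul])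
  mul_assoc a b c := hΦ (by simp only [hmul, hW.mul_assoc])
  inv_add a b := hΦ (by simp only [hinv, map_add, hW.inv_add])
  inv_smul r a := hΦ (by simp only [hinv, map_smul, hW.inv_smul])
  inv_mul a b := hΦ (by simp only [hinv, hmul, hW.inv_mul])
  inv_inv a := hΦ (by simp only [hinv, hW.inv_inv])

noncomputable section

namespace DQG

universe u

section Slices

variable {R M N P Q : Type*} [CommSemiring R] [AddCommMonoid M] [AddCommMonoid N]
  [AddCommMonoid P] [AddCommMonoid Q] [Module R M] [Module R N] [Module R P] [Module R Q]

/-- The slice map `id ⊗ f : M ⊗ N → M` of a functional `f` on `N`. -/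
def sliceR (f : N →ₗ[R] R) : M ⊗[R] N →ₗ[R] M :=
  (TensorProduct.rid R M).toLinearMap ∘ₗ f.lTensor M

/-- The slice map `f ⊗ id : M ⊗ N → N` of a functional `f` on `M`. -/
def sliceL (f : M →ₗ[R] R) : M ⊗[R] N →ₗ[R] N :=
  (TensorProduct.lid R N).toLinearMap ∘ₗ f.rTensor N

@[simp] theorem sliceR_tmul (f : N →ₗ[R] R) (x : M) (y : N) : sliceR f (x ⊗ₜ[R] y) = f y • x := rfl

@[simp] theorem sliceL_tmul (f : M →ₗ[R] R) (x : M) (y : N) : sliceL f (x ⊗ₜ[R] y) = f x • y := rfl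

theorem sliceR_rTensor (f : P →ₗ[R] R) (r : M →ₗ[R] N) (t : M ⊗[R] P) :
    sliceR f (r.rTensor P t) = r (sliceR f t) := by
  refine LinearMap.congr_fun (TensorProduct.ext' fun x y => ?_ : sliceR f ∘ₗ r.rTensor P
    = r ∘ₗ sliceR f) t
  simp

theorem sliceL_lTensor (f : P →ₗ[R] R) (r : M →ₗ[R] N) (t : P ⊗[R] M) :
    sliceL f (r.lTensor P t) = r (sliceL f t) := by
  refine LinearMap.congr_fun (TensorProduct.ext' fun x y => ?_ : sliceL f ∘ₗ r.lTensor P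
    = r ∘ₗ sliceL f) t
  simp

theorem sliceR_lTensor (f : N →ₗ[R] R) (r : P →ₗ[R] N) (t : M ⊗[R] P) :
    sliceR f (r.lTensor M t) = sliceR (f ∘ₗ r) t := by
  simp only [sliceR, LinearMap.comp_apply, LinearMap.lTensor_comp]

theorem sliceL_rTensor (f : N →ₗ[R] R) (r : P →ₗ[R] N) (t : P ⊗[R] M) :
    sliceL f (r.rTensor M t) = sliceL (f ∘ₗ r) t := by
  simp only [sliceL, LinearMap.comp_apply, LinearMap.rTensor_comp]

theorem sliceR_smul (r : R) (f : N →ₗ[R] R) :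
    sliceR (M := M) (r • f) = r • sliceR f := by
  rw [sliceR, LinearMap.lTensor_smul, LinearMap.comp_smul, sliceR]

theorem apply_sliceL (f : M →ₗ[R] R) (g : N →ₗ[R] R) (t : M ⊗[R] N) :
    g (sliceL f t) = f (sliceR g t) := by
  refine LinearMap.congr_fun (TensorProduct.ext' fun x y => ?_ : g ∘ₗ sliceL f
    = f ∘ₗ sliceR g) t
  simp [mul_comm]

theorem mul'_map_eq_apply_sliceR (f : M →ₗ[R] R) (g : N →ₗ[R] R) (t : M ⊗[R] N) :
    LinearMap.mul' R R (TensorProduct.map f g t) = f (sliceR g t) := by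
  refine LinearMap.congr_fun (TensorProduct.ext' fun x y => ?_ :
    LinearMap.mul' R R ∘ₗ TensorProduct.map f g = f ∘ₗ sliceR g) t
  simp [mul_comm]

theorem sliceR_assoc_symm_tmul (f : P →ₗ[R] R) (x : M) (t : N ⊗[R] P) :
    sliceR f ((TensorProduct.assoc R M N P).symm (x ⊗ₜ t)) = x ⊗ₜ sliceR f t := by
  refine LinearMap.congr_fun (TensorProduct.ext' fun y z => ?_ :
    sliceR f ∘ₗ (TensorProduct.assoc R M N P).symm.toLinearMap ∘ₗ TensorProduct.mk R M _ x
      = TensorProduct.mk R M N x ∘ₗ sliceR f) t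
  simp

theorem sliceL_assoc_tmul (f : M →ₗ[R] R) (t : M ⊗[R] N) (z : P) :
    sliceL f (TensorProduct.assoc R M N P (t ⊗ₜ z)) = sliceL f t ⊗ₜ z := by
  refine LinearMap.congr_fun (TensorProduct.ext' fun x y => ?_ :
    sliceL f ∘ₗ (TensorProduct.assoc R M N P).toLinearMap ∘ₗ (TensorProduct.mk R _ P).flip z
      = (TensorProduct.mk R N P).flip z ∘ₗ sliceL f) t
  simp [TensorProduct.smul_tmul']

theorem sliceR_assoc_symm_lTensor_assoc_tmul (f : Q →ₗ[R] R) (r : N ⊗[R] P →ₗ[R] N ⊗[R] Q)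
    (t : M ⊗[R] N) (z : P) :
    sliceR f ((TensorProduct.assoc R M N Q).symm (r.lTensor M (TensorProduct.assoc R M N P
      (t ⊗ₜ z)))) = (sliceR f ∘ₗ r ∘ₗ (TensorProduct.mk R N P).flip z).lTensor M t := by
  induction t with
  | zero => simp only [TensorProduct.zero_tmul, map_zero]
  | add x y hx hy => simp only [TensorProduct.add_tmul, map_add, hx, hy]
  | tmul x y => simp [sliceR_assoc_symm_tmul]

theorem sliceL_assoc_rTensor_assoc_symm_tmul (f : Q →ₗ[R] R) (r : M ⊗[R] N →ₗ[R] Q ⊗[R] N)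
    (x : M) (t : N ⊗[R] P) :
    sliceL f (TensorProduct.assoc R Q N P (r.rTensor P ((TensorProduct.assoc R M N P).symm
      (x ⊗ₜ t)))) = (sliceL f ∘ₗ r ∘ₗ TensorProduct.mk R M N x).rTensor P t := by
  induction t with
  | zero => simp only [TensorProduct.tmul_zero, map_zero]
  | add x y hx hy => simp only [TensorProduct.tmul_add, map_add, hx, hy]
  | tmul x y => simp [sliceL_assoc_tmul]

theorem eq_of_forall_sliceR [Module.Free R N] {s t : M ⊗[R] N}
    (h : ∀ f : N →ₗ[R] R, sliceR f s = sliceR f t) : s = t := by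
  classical
  let b := Module.Free.chooseBasis R N
  refine (TensorProduct.equivFinsuppOfBasisRight (M := M) b).injective (Finsupp.ext fun i => ?_)
  rw [TensorProduct.equivFinsuppOfBasisRight_apply, TensorProduct.equivFinsuppOfBasisRight_apply]
  exact h (b.coord i)

end Slices

variable {I : Type u} {n : I → ℕ}

namespace A₀

theorem ext {a b : A₀ n} (h : ∀ α, (a : Malg n) α = (b : Malg n) α) : a = b :=
  Subtype.ext (funext h)

theorem exists_support (a : A₀ n) : ∃ s : Finset I, ∀ α, α ∉ s → (a : Malg n) α = 0 := by
  have ha : {α | (a : Malg n) α ≠ 0}.Finite := a.2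
  exact ⟨ha.toFinset, fun α hα => not_not.1 fun h => hα (ha.mem_toFinset.2 h)⟩

end A₀

theorem single_apply_same (α : I) (M : Matrix (Fin (n α)) (Fin (n α)) ℂ) :
    (single α M : Malg n) α = M := by
  classical exact Pi.single_eq_same (M := fun γ => Matrix (Fin (n γ)) (Fin (n γ)) ℂ) α M

theorem single_apply_ne {α β : I} (h : β ≠ α) (M : Matrix (Fin (n α)) (Fin (n α)) ℂ) :
    (single α M : Malg n) β = 0 := by
  classical exact Pi.single_eq_of_ne (M := fun γ => Matrix (Fin (n γ)) (Fin (n γ)) ℂ) h M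

theorem mul_single (a : A₀ n) (α : I) (M : Matrix (Fin (n α)) (Fin (n α)) ℂ) :
    a * single α M = single α ((a : Malg n) α * M) := by
  classical exact Subtype.ext (Pi.single_mul_right (f := (a : Malg n)) M).symm

theorem single_mul (a : A₀ n) (α : I) (M : Matrix (Fin (n α)) (Fin (n α)) ℂ) :
    single α M * a = single α (M * (a : Malg n) α) := by
  classical exact Subtype.ext (Pi.single_mul_left (f := (a : Malg n)) M).symm

/-- The inclusion of the block `M_{n α}` in `A₀`, as a linear map. -/
def singleₗ (n : I → ℕ) (α : I) : Matrix (Fin (n α)) (Fin (n α)) ℂ →ₗ[ℂ] A₀ n where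
  toFun := single α
  map_add' M N := by
    classical
    exact Subtype.ext (Pi.single_add (f := fun γ => Matrix (Fin (n γ)) (Fin (n γ)) ℂ) α M N)
  map_smul' c M := by
    classical
    exact Subtype.ext (Pi.single_smul (f := fun γ => Matrix (Fin (n γ)) (Fin (n γ)) ℂ) α c M)

theorem single_zero (α : I) : (single α 0 : A₀ n) = 0 := map_zero (singleₗ n α)

theorem single_eq_sum_matrixUnit (α : I) (M : Matrix (Fin (n α)) (Fin (n α)) ℂ) :
    (single α M : A₀ n) = ∑ i, ∑ j, M i j • matrixUnit n α i j := by
  have hM : M = ∑ i, ∑ j, M i j • Matrix.single i j 1 := by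
    simpa only [Matrix.smul_single, smul_eq_mul, mul_one] using Matrix.matrix_eq_sum_single M
  have h := congrArg (singleₗ n α) hM
  simp only [map_sum, map_smul] at h
  exact h

theorem sum_single {a : A₀ n} {s : Finset I} (hs : ∀ α, α ∉ s → (a : Malg n) α = 0) :
    ∑ α ∈ s, single α ((a : Malg n) α) = a := by
  classical
  refine A₀.ext fun β => ?_
  have hsum : ((∑ α ∈ s, single α ((a : Malg n) α) : A₀ n) : Malg n)
      = ∑ α ∈ s, Pi.single α ((a : Malg n) α) := by
    simpa only [Submodule.subtype_apply] using!
      map_sum (A₀ n).toNonUnitalSubalgebra.toSubmodule.subtype (fun α => single α _) s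
  rw [hsum, Finset.sum_apply, Finset.sum_pi_single]
  split_ifs with hβ
  exacts [rfl, (hs β hβ).symm]

theorem linearMap_ext_single {V : Type*} [AddCommMonoid V] [Module ℂ V] {f g : A₀ n →ₗ[ℂ] V}
    (h : ∀ α M, f (single α M) = g (single α M)) : f = g := by
  refine LinearMap.ext fun a => ?_
  obtain ⟨s, hs⟩ := A₀.exists_support a
  rw [← sum_single hs, map_sum, map_sum]
  exact Finset.sum_congr rfl fun α _ => h α _

open Classical in
/-- The unit of `⨁_{α ∈ s} M_{n α}`: these elements are the local units of `A₀`. -/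
def blockUnit (n : I → ℕ) (s : Finset I) : A₀ n :=
  ⟨s.piecewise 1 0, s.finite_toSet.subset fun _ hα => not_not.1 fun h =>
    hα (s.piecewise_eq_of_notMem _ _ h)⟩

theorem blockUnit_apply_of_mem {s : Finset I} {α : I} (h : α ∈ s) :
    (blockUnit n s : Malg n) α = 1 := by
  classical exact s.piecewise_eq_of_mem _ _ h

theorem blockUnit_apply_of_notMem {s : Finset I} {α : I} (h : α ∉ s) :
    (blockUnit n s : Malg n) α = 0 := by
  classical exact s.piecewise_eq_of_notMem _ _ h

theorem star_blockUnit (s : Finset I) : star (blockUnit n s) = blockUnit n s := by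
  refine A₀.ext fun α => ?_
  change star ((blockUnit n s : Malg n) α) = _
  by_cases h : α ∈ s
  · rw [blockUnit_apply_of_mem h, star_one]
  · rw [blockUnit_apply_of_notMem h, star_zero]

theorem blockUnit_mul {a : A₀ n} {s : Finset I} (hs : ∀ α, α ∉ s → (a : Malg n) α = 0) :
    blockUnit n s * a = a := by
  refine A₀.ext fun α => ?_
  change (blockUnit n s : Malg n) α * (a : Malg n) α = _
  by_cases h : α ∈ s
  · rw [blockUnit_apply_of_mem h, one_mul]
  · rw [hs α h, mul_zero]

theorem mul_blockUnit {a : A₀ n} {s : Finset I} (hs : ∀ α, α ∉ s → (a : Malg n) α = 0) :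
    a * blockUnit n s = a := by
  refine A₀.ext fun α => ?_
  change (a : Malg n) α * (blockUnit n s : Malg n) α = _
  by_cases h : α ∈ s
  · rw [blockUnit_apply_of_mem h, mul_one]
  · rw [hs α h, zero_mul]

theorem exists_localUnit (a b : A₀ n) :
    ∃ e : A₀ n, star e = e ∧ (e * a = a ∧ a * e = a) ∧ e * b = b ∧ b * e = b := by
  classical
  obtain ⟨s, hs⟩ := A₀.exists_support a
  obtain ⟨t, ht⟩ := A₀.exists_support b
  have ha : ∀ α, α ∉ s ∪ t → (a : Malg n) α = 0 := fun α h =>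
    hs α fun hα => h (Finset.mem_union_left t hα)
  have hb : ∀ α, α ∉ s ∪ t → (b : Malg n) α = 0 := fun α h =>
    ht α fun hα => h (Finset.mem_union_right s hα)
  exact ⟨blockUnit n (s ∪ t), star_blockUnit _, ⟨blockUnit_mul ha, mul_blockUnit ha⟩,
    blockUnit_mul hb, mul_blockUnit hb⟩

theorem eq_of_forall_mul_right {a b : A₀ n} (h : ∀ c, a * c = b * c) : a = b := by
  obtain ⟨e, -, ⟨-, ha⟩, -, hb⟩ := exists_localUnit a b
  rw [← ha, h, hb]

theorem eq_of_forall_mul_left {a b : A₀ n} (h : ∀ c, c * a = c * b) : a = b := by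
  obtain ⟨e, -, ⟨ha, -⟩, hb, -⟩ := exists_localUnit a b
  rw [← ha, h, hb]

section Multipliers

theorem multLeft_mul (m : Malg n) (a b : A₀ n) : multLeft m (a * b) = multLeft m a * b :=
  Subtype.ext (mul_assoc _ _ _).symm

theorem multRight_mul (m : Malg n) (a b : A₀ n) : multRight m (a * b) = a * multRight m b :=
  Subtype.ext (mul_assoc _ _ _)

theorem mul_multLeft (m : Malg n) (a b : A₀ n) : a * multLeft m b = multRight m a * b :=
  Subtype.ext (mul_assoc _ _ _).symm

theorem star_multRight (m : Malg n) (a : A₀ n) :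
    star (multRight m a) = multLeft (star m) (star a) := Subtype.ext (star_mul _ _)

theorem multLeft_multLeft_of_mul_eq_one {m m' : Malg n} (h : m * m' = 1) (a : A₀ n) :
    multLeft m (multLeft m' a) = a := by
  refine Subtype.ext ?_
  change m * (m' * (a : Malg n)) = a
  rw [← mul_assoc, h, one_mul]

theorem multRight_multRight_of_mul_eq_one {m m' : Malg n} (h : m * m' = 1) (a : A₀ n) :
    multRight m' (multRight m a) = a := by
  refine Subtype.ext ?_
  change (a : Malg n) * m * m' = a
  rw [mul_assoc, h, mul_one]

end Multipliers

section FinSuppDual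

@[simp] theorem leftTranslate_apply (f : A₀ n →ₗ[ℂ] ℂ) (a x : A₀ n) :
    (leftTranslate f a).1 x = f (a * x) := rfl

/-- The finitely supported functional `f(· a)`. -/
def rightTranslate (f : A₀ n →ₗ[ℂ] ℂ) (a : A₀ n) : finSuppDual n :=
  ⟨f ∘ₗ LinearMap.mulRight ℂ a, by
    have ha : {α | (a : Malg n) α ≠ 0}.Finite := a.2
    refine ha.subset fun α ⟨M, hM⟩ hα => hM ?_
    rw [LinearMap.comp_apply, LinearMap.mulRight_apply, single_mul, hα, mul_zero, single_zero,
      map_zero]⟩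

@[simp] theorem rightTranslate_apply (f : A₀ n →ₗ[ℂ] ℂ) (a x : A₀ n) :
    (rightTranslate f a).1 x = f (x * a) := rfl

theorem exists_blockUnit_mul_eq (f : finSuppDual n) :
    ∃ e : A₀ n, ∀ x, f.1 (e * x) = f.1 x ∧ f.1 (x * e) = f.1 x := by
  have hf : {α | ∃ M, f.1 (single α M) ≠ 0}.Finite := f.2
  have hzero : ∀ y : A₀ n, (∀ α ∈ hf.toFinset, (y : Malg n) α = 0) → f.1 y = 0 := by
    intro y hy
    obtain ⟨s, hs⟩ := A₀.exists_support y
    rw [← sum_single hs, map_sum]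
    refine Finset.sum_eq_zero fun α _ => not_not.1 fun h => h ?_
    rw [hy α (hf.mem_toFinset.2 ⟨_, h⟩), single_zero, map_zero]
  refine ⟨blockUnit n hf.toFinset, fun x => ⟨?_, ?_⟩⟩ <;> rw [← sub_eq_zero, ← map_sub]
  · refine hzero _ fun α hα => ?_
    change (blockUnit n _ : Malg n) α * (x : Malg n) α - (x : Malg n) α = 0
    rw [blockUnit_apply_of_mem hα, one_mul, sub_self]
  · refine hzero _ fun α hα => ?_
    change (x : Malg n) α * (blockUnit n _ : Malg n) α - (x : Malg n) α = 0
    rw [blockUnit_apply_of_mem hα, mul_one, sub_self]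

theorem exists_eq_leftTranslate (f : finSuppDual n) :
    ∃ (g : A₀ n →ₗ[ℂ] ℂ) (e : A₀ n), f = leftTranslate g e := by
  obtain ⟨e, he⟩ := exists_blockUnit_mul_eq f
  exact ⟨f.1, e, Subtype.ext (LinearMap.ext fun x => (he x).1.symm)⟩

theorem exists_eq_rightTranslate (f : finSuppDual n) :
    ∃ (g : A₀ n →ₗ[ℂ] ℂ) (e : A₀ n), f = rightTranslate g e := by
  obtain ⟨e, he⟩ := exists_blockUnit_mul_eq f
  exact ⟨f.1, e, Subtype.ext (LinearMap.ext fun x => (he x).2.symm)⟩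

theorem eq_of_forall_finSuppDual {a b : A₀ n} (h : ∀ f : finSuppDual n, f.1 a = f.1 b) :
    a = b := by
  obtain ⟨e, -, ⟨ha, -⟩, hb, -⟩ := exists_localUnit a b
  rw [← ha, ← hb]
  refine sub_eq_zero.1 ((Module.forall_dual_apply_eq_zero_iff ℂ _).1 fun g => ?_)
  rw [map_sub, sub_eq_zero]
  exact h (leftTranslate g e)

/-- The map `a ↦ f(a ·)` as a linear map to the finitely supported functionals. -/
def leftTranslateₗ (f : A₀ n →ₗ[ℂ] ℂ) : A₀ n →ₗ[ℂ] finSuppDual n where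
  toFun := leftTranslate f
  map_add' a b := Subtype.ext (LinearMap.ext fun x => by simp [add_mul])
  map_smul' c a := Subtype.ext (LinearMap.ext fun x => by simp [smul_mul_assoc])

end FinSuppDual

section TensorSquare

theorem kron_mul_kron (a b c d : Malg n) :
    kron n a b * kron n c d = kron n (a * c) (b * d) :=
  funext fun _ => (Matrix.mul_kronecker_mul _ _ _ _).symm

theorem star_kron (a b : Malg n) : star (kron n a b) = kron n (star a) (star b) :=
  funext fun _ => Matrix.conjTranspose_kronecker _ _

theorem tensorIncl_tmul (a b : A₀ n) : tensorIncl n (a ⊗ₜ b) = kron n a b := rfl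

theorem tensorIncl_star (t : A₀ n ⊗[ℂ] A₀ n) : tensorIncl n (star t) = star (tensorIncl n t) := by
  induction t with
  | zero => simp only [star_zero, map_zero]
  | add x y hx hy => simp only [star_add, map_add, hx, hy]
  | tmul a b => exact (star_kron _ _).symm

/-- The map `X ↦ X_{αβ}`, as a linear map. -/
def componentₗ (n : I → ℕ) (p : I × I) : Malg₂ n →ₗ[ℂ] A₀ n ⊗[ℂ] A₀ n where
  toFun X := component X p
  map_add' X Y := by
    simp only [component, Pi.add_apply, Matrix.add_apply, add_smul, Finset.sum_add_distrib]
  map_smul' c X := by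
    simp only [component, Pi.smul_apply, Matrix.smul_apply, smul_eq_mul, mul_smul,
      Finset.smul_sum, RingHom.id_apply]

theorem component_zero (p : I × I) : component (0 : Malg₂ n) p = 0 := map_zero (componentₗ n p)

theorem component_add (X Y : Malg₂ n) (p : I × I) :
    component (X + Y) p = component X p + component Y p := map_add (componentₗ n p) X Y

theorem component_kron (a b : A₀ n) (p : I × I) :
    component (kron n a b) p
      = single p.1 ((a : Malg n) p.1) ⊗ₜ[ℂ] single p.2 ((b : Malg n) p.2) := by
  rw [single_eq_sum_matrixUnit, single_eq_sum_matrixUnit]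
  simp only [TensorProduct.sum_tmul]
  simp only [TensorProduct.tmul_sum, TensorProduct.smul_tmul_smul]
  rfl

theorem support_component_tensorIncl_finite (t : A₀ n ⊗[ℂ] A₀ n) :
    (Function.support fun p => component (tensorIncl n t) p).Finite := by
  induction t with
  | zero => simp only [map_zero, component_zero, Function.support_fun_zero, Set.finite_empty]
  | add x y hx hy =>
    simp only [map_add, component_add]
    exact (hx.union hy).subset (Function.support_add _ _)
  | tmul a b =>
    obtain ⟨s, hs⟩ := A₀.exists_support a
    obtain ⟨t, ht⟩ := A₀.exists_support b
    refine (s ×ˢ t).finite_toSet.subset fun p hp => Finset.mem_coe.2 (Finset.mem_product.2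
      ⟨not_not.1 fun h => hp ?_, not_not.1 fun h => hp ?_⟩)
    · simp only [tensorIncl_tmul, component_kron, hs _ h, single_zero, TensorProduct.zero_tmul]
    · simp only [tensorIncl_tmul, component_kron, ht _ h, single_zero, TensorProduct.tmul_zero]

theorem finsum_component_tensorIncl (t : A₀ n ⊗[ℂ] A₀ n) :
    ∑ᶠ p, component (tensorIncl n t) p = t := by
  induction t with
  | zero => simp only [map_zero, component_zero, finsum_zero]
  | add x y hx hy =>
    simp only [map_add, component_add]
    rw [finsum_add_distrib (support_component_tensorIncl_finite x)
      (support_component_tensorIncl_finite y), hx, hy]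
  | tmul a b =>
    obtain ⟨s, hs⟩ := A₀.exists_support a
    obtain ⟨t, ht⟩ := A₀.exists_support b
    rw [finsum_eq_sum_of_support_subset (s := s ×ˢ t)]
    · simp only [tensorIncl_tmul, component_kron, Finset.sum_product, ← TensorProduct.tmul_sum,
        ← TensorProduct.sum_tmul, sum_single hs, sum_single ht]
    · refine fun p hp => Finset.mem_coe.2 (Finset.mem_product.2
        ⟨not_not.1 fun h => hp ?_, not_not.1 fun h => hp ?_⟩)
      · simp only [tensorIncl_tmul, component_kron, hs _ h, single_zero, TensorProduct.zero_tmul]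
      · simp only [tensorIncl_tmul, component_kron, ht _ h, single_zero, TensorProduct.tmul_zero]

theorem tensorIncl_injective : Function.Injective (tensorIncl n) :=
  Function.LeftInverse.injective (g := fun X => ∑ᶠ p, component X p) finsum_component_tensorIncl

theorem evalMult_tensorIncl {V : Type*} [AddCommGroup V] [Module ℂ V]
    (F : A₀ n ⊗[ℂ] A₀ n →ₗ[ℂ] V) (t : A₀ n ⊗[ℂ] A₀ n) :
    evalMult F (tensorIncl n t) = F t := by
  conv_rhs => rw [← finsum_component_tensorIncl t]
  exact (map_finsum F (support_component_tensorIncl_finite t)).symm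

open Classical in
theorem tensorIncl_component (X : Malg₂ n) (p : I × I) :
    tensorIncl n (component X p) = Pi.single p (X p) := by
  funext q
  have hX : tensorIncl n (component X p) q = ∑ i, ∑ j, ∑ k, ∑ l, X p (i, k) (j, l) •
      Matrix.kronecker ((matrixUnit n p.1 i j : Malg n) q.1)
        ((matrixUnit n p.2 k l : Malg n) q.2) := by
    simp only [component, map_sum, map_smul, tensorIncl_tmul, Finset.sum_apply, Pi.smul_apply]
    rfl
  rw [hX]
  by_cases hq : q = p
  · subst hq
    rw [Pi.single_eq_same]
    conv_rhs => rw [Matrix.matrix_eq_sum_single (X q)]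
    simp only [matrixUnit, single_apply_same, Fintype.sum_prod_type]
    refine Finset.sum_congr rfl fun i _ => Finset.sum_comm.trans ?_
    refine Finset.sum_congr rfl fun k _ => Finset.sum_congr rfl fun j _ =>
      Finset.sum_congr rfl fun l _ => ?_
    refine (congrArg _ (Matrix.single_kronecker_single i j k l (1 : ℂ) 1)).trans ?_
    rw [Matrix.smul_single, smul_eq_mul, mul_one, mul_one]
  · rw [Pi.single_eq_of_ne hq]
    refine Finset.sum_eq_zero fun i _ => Finset.sum_eq_zero fun j _ =>
      Finset.sum_eq_zero fun k _ => Finset.sum_eq_zero fun l _ => ?_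
    rw [Prod.ext_iff, not_and_or] at hq
    rcases hq with hq | hq <;> rw [matrixUnit, matrixUnit, single_apply_ne hq]
    · exact (congrArg _ (Matrix.zero_kronecker _)).trans (smul_zero _)
    · exact (congrArg _ (Matrix.kronecker_zero _)).trans (smul_zero _)

theorem component_star (X : Malg₂ n) (p : I × I) : component (star X) p = star (component X p) := by
  classical
  refine tensorIncl_injective ?_
  rw [tensorIncl_star, tensorIncl_component, tensorIncl_component, Pi.star_apply]
  exact Pi.single_star (f := fun q : I × I =>
    Matrix (Fin (n q.1) × Fin (n q.2)) (Fin (n q.1) × Fin (n q.2)) ℂ) p (X p)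

/-- `t ↦ (a ⊗ 1) t`. -/
abbrev mulLeftFst (a : A₀ n) : A₀ n ⊗[ℂ] A₀ n →ₗ[ℂ] A₀ n ⊗[ℂ] A₀ n :=
  (LinearMap.mulLeft ℂ a).rTensor (A₀ n)

/-- `t ↦ (1 ⊗ a) t`. -/
abbrev mulLeftSnd (a : A₀ n) : A₀ n ⊗[ℂ] A₀ n →ₗ[ℂ] A₀ n ⊗[ℂ] A₀ n :=
  (LinearMap.mulLeft ℂ a).lTensor (A₀ n)

/-- `t ↦ t (a ⊗ 1)`. -/
abbrev mulRightFst (a : A₀ n) : A₀ n ⊗[ℂ] A₀ n →ₗ[ℂ] A₀ n ⊗[ℂ] A₀ n :=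
  (LinearMap.mulRight ℂ a).rTensor (A₀ n)

/-- `t ↦ t (1 ⊗ a)`. -/
abbrev mulRightSnd (a : A₀ n) : A₀ n ⊗[ℂ] A₀ n →ₗ[ℂ] A₀ n ⊗[ℂ] A₀ n :=
  (LinearMap.mulRight ℂ a).lTensor (A₀ n)

theorem mul'_mulLeftFst (a : A₀ n) (t : A₀ n ⊗[ℂ] A₀ n) :
    LinearMap.mul' ℂ (A₀ n) (mulLeftFst a t) = a * LinearMap.mul' ℂ (A₀ n) t :=
  LinearMap.congr_fun (TensorProduct.ext' fun x y => mul_assoc a x y :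
    LinearMap.mul' ℂ (A₀ n) ∘ₗ mulLeftFst a
      = LinearMap.mulLeft ℂ a ∘ₗ LinearMap.mul' ℂ (A₀ n)) t

theorem mul'_mulRightSnd (a : A₀ n) (t : A₀ n ⊗[ℂ] A₀ n) :
    LinearMap.mul' ℂ (A₀ n) (mulRightSnd a t) = LinearMap.mul' ℂ (A₀ n) t * a :=
  LinearMap.congr_fun (TensorProduct.ext' fun x y => (mul_assoc x y a).symm :
    LinearMap.mul' ℂ (A₀ n) ∘ₗ mulRightSnd a
      = LinearMap.mulRight ℂ a ∘ₗ LinearMap.mul' ℂ (A₀ n)) t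

theorem tensorIncl_mulLeftFst (a : A₀ n) (t : A₀ n ⊗[ℂ] A₀ n) :
    tensorIncl n (mulLeftFst a t) = kron n a 1 * tensorIncl n t := by
  refine LinearMap.congr_fun (TensorProduct.ext' fun x y => ?_ :
    tensorIncl n ∘ₗ mulLeftFst a = LinearMap.mulLeft ℂ (kron n a 1) ∘ₗ tensorIncl n) t
  change kron n ((a : Malg n) * x) y = kron n a 1 * kron n x y
  rw [kron_mul_kron, one_mul]

theorem tensorIncl_mulLeftSnd (a : A₀ n) (t : A₀ n ⊗[ℂ] A₀ n) :
    tensorIncl n (mulLeftSnd a t) = kron n 1 a * tensorIncl n t := by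
  refine LinearMap.congr_fun (TensorProduct.ext' fun x y => ?_ :
    tensorIncl n ∘ₗ mulLeftSnd a = LinearMap.mulLeft ℂ (kron n 1 a) ∘ₗ tensorIncl n) t
  change kron n x ((a : Malg n) * y) = kron n 1 a * kron n x y
  rw [kron_mul_kron, one_mul]

theorem tensorIncl_mulRightFst (a : A₀ n) (t : A₀ n ⊗[ℂ] A₀ n) :
    tensorIncl n (mulRightFst a t) = tensorIncl n t * kron n a 1 := by
  refine LinearMap.congr_fun (TensorProduct.ext' fun x y => ?_ :
    tensorIncl n ∘ₗ mulRightFst a = LinearMap.mulRight ℂ (kron n a 1) ∘ₗ tensorIncl n) t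
  change kron n ((x : Malg n) * a) y = kron n x y * kron n a 1
  rw [kron_mul_kron, mul_one]

theorem tensorIncl_mulRightSnd (a : A₀ n) (t : A₀ n ⊗[ℂ] A₀ n) :
    tensorIncl n (mulRightSnd a t) = tensorIncl n t * kron n 1 a := by
  refine LinearMap.congr_fun (TensorProduct.ext' fun x y => ?_ :
    tensorIncl n ∘ₗ mulRightSnd a = LinearMap.mulRight ℂ (kron n 1 a) ∘ₗ tensorIncl n) t
  change kron n x ((y : Malg n) * a) = kron n x y * kron n 1 a
  rw [kron_mul_kron, mul_one]

theorem mulLeftFst_component (a : A₀ n) (X : Malg₂ n) (p : I × I) :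
    mulLeftFst a (component X p) = component (kron n a 1 * X) p := by
  classical
  refine tensorIncl_injective ?_
  rw [tensorIncl_mulLeftFst, tensorIncl_component, tensorIncl_component, Pi.mul_apply]
  exact (Pi.single_mul_right (f := kron n (a : Malg n) 1) (X p)).symm

theorem mulRightSnd_component (a : A₀ n) (X : Malg₂ n) (p : I × I) :
    mulRightSnd a (component X p) = component (X * kron n 1 a) p := by
  classical
  refine tensorIncl_injective ?_
  rw [tensorIncl_mulRightSnd, tensorIncl_component, tensorIncl_component, Pi.mul_apply]
  exact (Pi.single_mul_left (f := kron n 1 (a : Malg n)) (X p)).symm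

theorem evalMult_comp_mulLeftFst {V : Type*} [AddCommGroup V] [Module ℂ V]
    (F : A₀ n ⊗[ℂ] A₀ n →ₗ[ℂ] V) (a : A₀ n) (X : Malg₂ n) :
    evalMult (F ∘ₗ mulLeftFst a) X = evalMult F (kron n a 1 * X) := by
  simp only [evalMult, LinearMap.comp_apply, mulLeftFst_component]

theorem evalMult_comp_mulRightSnd {V : Type*} [AddCommGroup V] [Module ℂ V]
    (F : A₀ n ⊗[ℂ] A₀ n →ₗ[ℂ] V) (a : A₀ n) (X : Malg₂ n) :
    evalMult (F ∘ₗ mulRightSnd a) X = evalMult F (X * kron n 1 a) := by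
  simp only [evalMult, LinearMap.comp_apply, mulRightSnd_component]

end TensorSquare

theorem mem_finSuppDual_of_mulLeftFst (F : A₀ n ⊗[ℂ] A₀ n →ₗ[ℂ] ℂ) (s : A₀ n ⊗[ℂ] A₀ n)
    {h : A₀ n →ₗ[ℂ] ℂ} (hF : ∀ x, h x = F (mulLeftFst x s)) : h ∈ finSuppDual n := by
  let mulLeftFstₗ := (LinearMap.rTensorHom (A₀ n) ∘ₗ LinearMap.mul ℂ (A₀ n)).flip
  rw [show h = F ∘ₗ mulLeftFstₗ s from LinearMap.ext hF]
  clear hF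
  induction s with
  | zero =>
    rw [map_zero, LinearMap.comp_zero]
    exact zero_mem _
  | add s t hs ht =>
    rw [map_add, LinearMap.comp_add]
    exact add_mem hs ht
  | tmul a b => exact (rightTranslate (F ∘ₗ (TensorProduct.mk ℂ (A₀ n) (A₀ n)).flip b) a).2

/-- The conjugate functional `x ↦ conj (f(x*))`. -/
def conjDual (f : A₀ n →ₗ[ℂ] ℂ) : A₀ n →ₗ[ℂ] ℂ where
  toFun x := star (f (star x))
  map_add' x y := by rw [star_add, map_add, star_add]
  map_smul' c x := by rw [star_smul, map_smul, star_smul, star_star, RingHom.id_apply]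

@[simp] theorem conjDual_apply (f : A₀ n →ₗ[ℂ] ℂ) (x : A₀ n) :
    conjDual f x = star (f (star x)) := rfl

/-- The conjugation `f ↦ conj (f(·*))` of `A₀'`. -/
def conjFinSuppDual (f : finSuppDual n) : finSuppDual n :=
  ⟨conjDual f.1, by
    obtain ⟨g, e, rfl⟩ := exists_eq_rightTranslate f
    convert (leftTranslate (conjDual g) (star e)).2 using 1
    exact LinearMap.ext fun x => by simp [star_mul]⟩

@[simp] theorem conjFinSuppDual_apply (f : finSuppDual n) (x : A₀ n) :
    (conjFinSuppDual f).1 x = star (f.1 (star x)) := rfl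

theorem map_conjDual_star (f g : A₀ n →ₗ[ℂ] ℂ) (t : A₀ n ⊗[ℂ] A₀ n) :
    LinearMap.mul' ℂ ℂ (TensorProduct.map f g (star t))
      = star (LinearMap.mul' ℂ ℂ (TensorProduct.map (conjDual f) (conjDual g) t)) := by
  induction t with
  | zero => simp only [star_zero, map_zero]
  | add x y hx hy => simp only [star_add, map_add, hx, hy]
  | tmul a b => simp

theorem evalMult_star (f g : A₀ n →ₗ[ℂ] ℂ) (X : Malg₂ n) :
    evalMult (LinearMap.mul' ℂ ℂ ∘ₗ TensorProduct.map f g) (star X)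
      = star (evalMult (LinearMap.mul' ℂ ℂ ∘ₗ
          TensorProduct.map (conjDual f) (conjDual g)) X) := by
  simp only [evalMult, component_star, LinearMap.comp_apply, map_conjDual_star]
  exact ((starAddEquiv (R := ℂ)).toAddMonoidHom.map_finsum_of_injective
    (starAddEquiv (R := ℂ)).injective _).symm

theorem apply_star_of_nonneg {φ : A₀ n →ₗ[ℂ] ℂ} (hφ : ∀ a, 0 ≤ φ (star a * a)) (a : A₀ n) :
    φ (star a) = star (φ a) := by
  obtain ⟨e, he, ⟨hea, -⟩, -, hae⟩ := exists_localUnit a (star a)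
  have him (x : A₀ n) : (φ (star x * x)).im = 0 := ((Complex.le_def.1 (hφ x)).2).symm
  have h_add := him (a + e)
  have h_add_I := him (a + Complex.I • e)
  have h_a := him a
  have h_e := him e
  rw [he] at h_e
  simp only [star_add, star_smul, he, add_mul, mul_add, smul_mul_assoc, mul_smul_comm, hea, hae,
    map_add, map_smul, Complex.add_im, smul_eq_mul, Complex.star_def, Complex.conj_I]
    at h_add h_add_I
  simp only [Complex.mul_im, Complex.mul_re, Complex.neg_re, Complex.neg_im, Complex.I_re,
    Complex.I_im] at h_add_I
  apply Complex.ext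
  · rw [Complex.star_def, Complex.conj_re]
    linarith
  · rw [Complex.star_def, Complex.conj_im]
    linarith

end DQG

namespace DiscreteQuantumGroup

universe u

variable {I : Type u} {n : I → ℕ} (D : DiscreteQuantumGroup I n)

theorem comul_mul (a b : A₀ n) : D.comul (a * b) = D.comul a * D.comul b :=
  congrArg Subtype.val (map_mul D.Δ (toMbdd a) (toMbdd b))

theorem comul_star (a : A₀ n) : D.comul (star a) = star (D.comul a) :=
  congrArg Subtype.val (map_star D.Δ (toMbdd a))

theorem tensorIncl_T₁ (a b : A₀ n) :
    tensorIncl n (D.T₁ (a ⊗ₜ b)) = D.comul a * kron n 1 b := D.T₁_spec a b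

theorem tensorIncl_T₂ (a b : A₀ n) :
    tensorIncl n (D.T₂ (a ⊗ₜ b)) = kron n a 1 * D.comul b := D.T₂_spec a b

theorem tensorIncl_T₁_mulLeftFst (a : A₀ n) (t : A₀ n ⊗[ℂ] A₀ n) :
    tensorIncl n (D.T₁ (mulLeftFst a t)) = D.comul a * tensorIncl n (D.T₁ t) := by
  refine LinearMap.congr_fun (TensorProduct.ext' fun x y => ?_ :
    tensorIncl n ∘ₗ D.T₁.toLinearMap ∘ₗ mulLeftFst a
      = LinearMap.mulLeft ℂ (D.comul a) ∘ₗ tensorIncl n ∘ₗ D.T₁.toLinearMap) t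
  change tensorIncl n (D.T₁ ((a * x) ⊗ₜ y)) = D.comul a * tensorIncl n (D.T₁ (x ⊗ₜ y))
  rw [tensorIncl_T₁, tensorIncl_T₁, comul_mul, mul_assoc]

theorem tensorIncl_T₂_mulRightSnd (a : A₀ n) (t : A₀ n ⊗[ℂ] A₀ n) :
    tensorIncl n (D.T₂ (mulRightSnd a t)) = tensorIncl n (D.T₂ t) * D.comul a := by
  refine LinearMap.congr_fun (TensorProduct.ext' fun x y => ?_ :
    tensorIncl n ∘ₗ D.T₂.toLinearMap ∘ₗ mulRightSnd a
      = LinearMap.mulRight ℂ (D.comul a) ∘ₗ tensorIncl n ∘ₗ D.T₂.toLinearMap) t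
  change tensorIncl n (D.T₂ (x ⊗ₜ (y * a))) = tensorIncl n (D.T₂ (x ⊗ₜ y)) * D.comul a
  rw [tensorIncl_T₂, tensorIncl_T₂, comul_mul, mul_assoc]

theorem mulRightFst_T₁ (p a q : A₀ n) :
    mulRightFst p (D.T₁ (a ⊗ₜ q)) = D.T₁ (mulLeftFst a (D.T₁.symm (p ⊗ₜ q))) := by
  refine tensorIncl_injective ?_
  rw [tensorIncl_mulRightFst, tensorIncl_T₁_mulLeftFst, tensorIncl_T₁,
    LinearEquiv.apply_symm_apply, tensorIncl_tmul, mul_assoc, kron_mul_kron, one_mul, mul_one]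

theorem mulLeftSnd_T₂ (p a q : A₀ n) :
    mulLeftSnd q (D.T₂ (p ⊗ₜ a)) = D.T₂ (mulRightSnd a (D.T₂.symm (p ⊗ₜ q))) := by
  refine tensorIncl_injective ?_
  rw [tensorIncl_mulLeftSnd, tensorIncl_T₂_mulRightSnd, tensorIncl_T₂,
    LinearEquiv.apply_symm_apply, tensorIncl_tmul, ← mul_assoc, kron_mul_kron, one_mul, mul_one]

theorem mulLeftFst_T₁ (a b c : A₀ n) :
    mulLeftFst c (D.T₁ (a ⊗ₜ b)) = mulRightSnd b (D.T₂ (c ⊗ₜ a)) := by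
  refine tensorIncl_injective ?_
  rw [tensorIncl_mulLeftFst, tensorIncl_mulRightSnd, tensorIncl_T₁, tensorIncl_T₂, mul_assoc]

section Actions

theorem evalMult_comp_mulRightSnd_comul {V : Type*} [AddCommGroup V] [Module ℂ V]
    (F : A₀ n ⊗[ℂ] A₀ n →ₗ[ℂ] V) (a b : A₀ n) :
    evalMult (F ∘ₗ mulRightSnd b) (D.comul a) = F (D.T₁ (a ⊗ₜ b)) := by
  rw [evalMult_comp_mulRightSnd, ← tensorIncl_T₁, evalMult_tensorIncl]

theorem evalMult_comp_mulLeftFst_comul {V : Type*} [AddCommGroup V] [Module ℂ V]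
    (F : A₀ n ⊗[ℂ] A₀ n →ₗ[ℂ] V) (a b : A₀ n) :
    evalMult (F ∘ₗ mulLeftFst a) (D.comul b) = F (D.T₂ (a ⊗ₜ b)) := by
  rw [evalMult_comp_mulLeftFst, ← tensorIncl_T₂, evalMult_tensorIncl]

theorem evalMult_sliceR_rightTranslate (g : A₀ n →ₗ[ℂ] ℂ) (a c : A₀ n) :
    evalMult (sliceR (rightTranslate g c).1) (D.comul a) = sliceR g (D.T₁ (a ⊗ₜ c)) := by
  rw [← evalMult_comp_mulRightSnd_comul]
  exact congrArg (evalMult · _) (LinearMap.ext fun t => (sliceR_lTensor g _ t).symm)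

theorem evalMult_sliceL_leftTranslate (g : A₀ n →ₗ[ℂ] ℂ) (a c : A₀ n) :
    evalMult (sliceL (leftTranslate g c).1) (D.comul a) = sliceL g (D.T₂ (c ⊗ₜ a)) := by
  rw [← evalMult_comp_mulLeftFst_comul]
  exact congrArg (evalMult · _) (LinearMap.ext fun t => (sliceL_rTensor g _ t).symm)

/-- The left action `a ↦ (id ⊗ f)(Δ(a))` of the convolution algebra `A₀'` on `A₀`. -/
def leftAct (f : finSuppDual n) : A₀ n →ₗ[ℂ] A₀ n where
  toFun a := evalMult (sliceR f.1) (D.comul a)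
  map_add' a b := by
    obtain ⟨g, c, rfl⟩ := exists_eq_rightTranslate f
    simp only [evalMult_sliceR_rightTranslate, TensorProduct.add_tmul, map_add]
  map_smul' r a := by
    obtain ⟨g, c, rfl⟩ := exists_eq_rightTranslate f
    simp only [evalMult_sliceR_rightTranslate, ← TensorProduct.smul_tmul', map_smul,
      RingHom.id_apply]

/-- The right action `a ↦ (f ⊗ id)(Δ(a))` of the convolution algebra `A₀'` on `A₀`. -/
def rightAct (f : finSuppDual n) : A₀ n →ₗ[ℂ] A₀ n where
  toFun a := evalMult (sliceL f.1) (D.comul a)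
  map_add' a b := by
    obtain ⟨g, c, rfl⟩ := exists_eq_leftTranslate f
    simp only [evalMult_sliceL_leftTranslate, TensorProduct.tmul_add, map_add]
  map_smul' r a := by
    obtain ⟨g, c, rfl⟩ := exists_eq_leftTranslate f
    simp only [evalMult_sliceL_leftTranslate, TensorProduct.tmul_smul, map_smul,
      RingHom.id_apply]

theorem leftAct_rightTranslate (g : A₀ n →ₗ[ℂ] ℂ) (a c : A₀ n) :
    D.leftAct (rightTranslate g c) a = sliceR g (D.T₁ (a ⊗ₜ c)) :=
  D.evalMult_sliceR_rightTranslate g a c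

theorem rightAct_leftTranslate (g : A₀ n →ₗ[ℂ] ℂ) (a c : A₀ n) :
    D.rightAct (leftTranslate g c) a = sliceL g (D.T₂ (c ⊗ₜ a)) :=
  D.evalMult_sliceL_leftTranslate g a c

theorem mul_leftAct (f : finSuppDual n) (a b : A₀ n) :
    a * D.leftAct f b = sliceR f.1 (D.T₂ (a ⊗ₜ b)) := by
  obtain ⟨g, c, rfl⟩ := exists_eq_rightTranslate f
  rw [leftAct_rightTranslate, ← LinearMap.mulLeft_apply (R := ℂ), ← sliceR_rTensor, mulLeftFst_T₁,
    sliceR_lTensor]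
  rfl

theorem rightAct_mul (f : finSuppDual n) (a b : A₀ n) :
    D.rightAct f a * b = sliceL f.1 (D.T₁ (a ⊗ₜ b)) := by
  obtain ⟨g, c, rfl⟩ := exists_eq_leftTranslate f
  rw [rightAct_leftTranslate, ← LinearMap.mulRight_apply (R := ℂ), ← sliceL_lTensor,
    ← mulLeftFst_T₁, sliceL_rTensor]
  rfl

theorem apply_leftAct (f g : finSuppDual n) (a : A₀ n) : f.1 (D.leftAct g a) = D.conv f g a := by
  obtain ⟨g, c, rfl⟩ := exists_eq_rightTranslate g
  have hconv : LinearMap.mul' ℂ ℂ ∘ₗ TensorProduct.map f.1 (rightTranslate g c).1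
      = (LinearMap.mul' ℂ ℂ ∘ₗ TensorProduct.map f.1 g) ∘ₗ mulRightSnd c :=
    TensorProduct.ext' fun _ _ => rfl
  rw [conv, hconv, evalMult_comp_mulRightSnd_comul, leftAct_rightTranslate,
    ← mul'_map_eq_apply_sliceR, LinearMap.comp_apply]

theorem apply_rightAct (f g : finSuppDual n) (a : A₀ n) :
    g.1 (D.rightAct f a) = D.conv f g a := by
  obtain ⟨f, c, rfl⟩ := exists_eq_leftTranslate f
  have hconv : LinearMap.mul' ℂ ℂ ∘ₗ TensorProduct.map (leftTranslate f c).1 g.1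
      = (LinearMap.mul' ℂ ℂ ∘ₗ TensorProduct.map f g.1) ∘ₗ mulLeftFst c :=
    TensorProduct.ext' fun _ _ => rfl
  rw [conv, hconv, evalMult_comp_mulLeftFst_comul, rightAct_leftTranslate, apply_sliceL,
    ← mul'_map_eq_apply_sliceR, LinearMap.comp_apply]

theorem T₂_lTensor_leftAct (f : finSuppDual n) (t : A₀ n ⊗[ℂ] A₀ n) :
    D.T₂ ((D.leftAct f).lTensor (A₀ n) t) = (D.leftAct f).lTensor (A₀ n) (D.T₂ t) := by
  obtain ⟨g, c, rfl⟩ := exists_eq_rightTranslate f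
  refine LinearMap.congr_fun (TensorProduct.ext' fun a b => ?_ :
    D.T₂.toLinearMap ∘ₗ (D.leftAct (rightTranslate g c)).lTensor (A₀ n)
      = (D.leftAct (rightTranslate g c)).lTensor (A₀ n) ∘ₗ D.T₂.toLinearMap) t
  have hact : sliceR g ∘ₗ D.T₁.toLinearMap ∘ₗ (TensorProduct.mk ℂ (A₀ n) (A₀ n)).flip c
      = D.leftAct (rightTranslate g c) :=
    LinearMap.ext fun b => (D.leftAct_rightTranslate g b c).symm
  have hcoassoc := congrArg (sliceR g) (D.coassoc a b c)
  rw [sliceR_rTensor, sliceR_assoc_symm_tmul, sliceR_assoc_symm_lTensor_assoc_tmul, hact,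
    ← leftAct_rightTranslate] at hcoassoc
  exact hcoassoc

theorem T₁_rTensor_rightAct (f : finSuppDual n) (t : A₀ n ⊗[ℂ] A₀ n) :
    D.T₁ ((D.rightAct f).rTensor (A₀ n) t) = (D.rightAct f).rTensor (A₀ n) (D.T₁ t) := by
  obtain ⟨g, c, rfl⟩ := exists_eq_leftTranslate f
  refine LinearMap.congr_fun (TensorProduct.ext' fun a b => ?_ :
    D.T₁.toLinearMap ∘ₗ (D.rightAct (leftTranslate g c)).rTensor (A₀ n)
      = (D.rightAct (leftTranslate g c)).rTensor (A₀ n) ∘ₗ D.T₁.toLinearMap) t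
  have hact : sliceL g ∘ₗ D.T₂.toLinearMap ∘ₗ TensorProduct.mk ℂ (A₀ n) (A₀ n) c
      = D.rightAct (leftTranslate g c) :=
    LinearMap.ext fun b => (D.rightAct_leftTranslate g b c).symm
  have hcoassoc := congrArg
    (fun z => sliceL g (TensorProduct.assoc ℂ (A₀ n) (A₀ n) (A₀ n) z)) (D.coassoc c a b)
  simp only [sliceL_assoc_rTensor_assoc_symm_tmul, hact, LinearEquiv.apply_symm_apply,
    sliceL_lTensor, sliceL_assoc_tmul, ← rightAct_leftTranslate] at hcoassoc
  exact hcoassoc.symm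

theorem rightAct_leftAct (f g : finSuppDual n) (a : A₀ n) :
    D.rightAct f (D.leftAct g a) = D.leftAct g (D.rightAct f a) := by
  obtain ⟨f, c, rfl⟩ := exists_eq_leftTranslate f
  rw [rightAct_leftTranslate, rightAct_leftTranslate, ← sliceL_lTensor, ← T₂_lTensor_leftAct,
    LinearMap.lTensor_tmul]

end Actions

theorem conv_star (f g : finSuppDual n) (x : A₀ n) :
    D.conv f g (star x) = star (D.conv (conjFinSuppDual f) (conjFinSuppDual g) x) := by
  rw [conv, comul_star, evalMult_star]
  rfl

theorem star_leftAct (f : finSuppDual n) (a : A₀ n) :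
    star (D.leftAct f a) = D.leftAct (conjFinSuppDual f) (star a) := by
  refine eq_of_forall_finSuppDual fun g => ?_
  have hconj : conjFinSuppDual (conjFinSuppDual f) = f :=
    Subtype.ext (LinearMap.ext fun x => by simp)
  have h := D.conv_star g (conjFinSuppDual f) a
  rw [hconj, ← apply_leftAct, ← apply_leftAct, conjFinSuppDual_apply, star_star] at h
  exact h.symm

section Counit

theorem mul'_rTensor_rightAct (f : finSuppDual n) (t : A₀ n ⊗[ℂ] A₀ n) :
    LinearMap.mul' ℂ (A₀ n) ((D.rightAct f).rTensor (A₀ n) t) = sliceL f.1 (D.T₁ t) :=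
  LinearMap.congr_fun (TensorProduct.ext' fun x y => D.rightAct_mul f x y :
    LinearMap.mul' ℂ (A₀ n) ∘ₗ (D.rightAct f).rTensor (A₀ n)
      = sliceL f.1 ∘ₗ D.T₁.toLinearMap) t

theorem mul'_T₁_symm_rightAct (f : finSuppDual n) (b c : A₀ n) :
    LinearMap.mul' ℂ (A₀ n) (D.T₁.symm (D.rightAct f b ⊗ₜ c)) = f.1 b • c := by
  have h : D.T₁.symm (D.rightAct f b ⊗ₜ c)
      = (D.rightAct f).rTensor (A₀ n) (D.T₁.symm (b ⊗ₜ c)) := by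
    rw [LinearEquiv.symm_apply_eq, T₁_rTensor_rightAct, LinearEquiv.apply_symm_apply,
      LinearMap.rTensor_tmul]
  rw [h, mul'_rTensor_rightAct, LinearEquiv.apply_symm_apply, sliceL_tmul]

theorem smul_mul'_T₁_symm (f : A₀ n →ₗ[ℂ] ℂ) (a b c : A₀ n) :
    f a • LinearMap.mul' ℂ (A₀ n) (D.T₁.symm (b ⊗ₜ c))
      = f (LinearMap.mul' ℂ (A₀ n) (D.T₂.symm (a ⊗ₜ b))) • c := by
  have h : LinearMap.mul' ℂ (A₀ n) ∘ₗ D.T₁.symm.toLinearMap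
        ∘ₗ (TensorProduct.mk ℂ (A₀ n) (A₀ n)).flip c ∘ₗ sliceL f ∘ₗ D.T₂.toLinearMap
      = (LinearMap.toSpanSingleton ℂ (A₀ n) c) ∘ₗ f ∘ₗ LinearMap.mul' ℂ (A₀ n) :=
    TensorProduct.ext' fun x y => by
      have := D.mul'_T₁_symm_rightAct (leftTranslate f x) y c
      rwa [rightAct_leftTranslate] at this
  have h' := LinearMap.congr_fun h (D.T₂.symm (a ⊗ₜ b))
  simp only [LinearMap.comp_apply, LinearEquiv.coe_coe, LinearEquiv.apply_symm_apply, sliceL_tmul,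
    map_smul] at h'
  exact h'

theorem exists_counit : ∃ ε : A₀ n →ₗ[ℂ] ℂ, D.IsCounit ε := by
  rcases subsingleton_or_nontrivial (A₀ n) with _ | _
  · exact ⟨0, fun _ _ => Subsingleton.elim _ _, fun _ _ => Subsingleton.elim _ _⟩
  obtain ⟨a₀, ha₀⟩ := exists_ne (0 : A₀ n)
  obtain ⟨f, hf⟩ := Module.Projective.exists_dual_eq_one ℂ ha₀
  let ε : A₀ n →ₗ[ℂ] ℂ := f ∘ₗ LinearMap.mul' ℂ (A₀ n) ∘ₗ D.T₂.symm.toLinearMap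
    ∘ₗ TensorProduct.mk ℂ (A₀ n) (A₀ n) a₀
  have hT₁ (b c : A₀ n) : LinearMap.mul' ℂ (A₀ n) (D.T₁.symm (b ⊗ₜ c)) = ε b • c := by
    have h := D.smul_mul'_T₁_symm f a₀ b c
    rwa [hf, one_smul] at h
  have hT₂ (a b : A₀ n) : LinearMap.mul' ℂ (A₀ n) (D.T₂.symm (a ⊗ₜ b)) = ε b • a := by
    refine sub_eq_zero.1 ((Module.forall_dual_apply_eq_zero_iff ℂ _).1 fun g => ?_)
    have h := congrArg f (D.smul_mul'_T₁_symm g a b a₀)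
    simp only [hT₁, map_smul, hf, smul_eq_mul, mul_one] at h
    rw [map_sub, ← h, map_smul, smul_eq_mul, mul_comm, sub_self]
  have hsliceL : sliceL ε = LinearMap.mul' ℂ (A₀ n) ∘ₗ D.T₁.symm.toLinearMap :=
    TensorProduct.ext' fun b c => (hT₁ b c).symm
  have hsliceR : sliceR ε = LinearMap.mul' ℂ (A₀ n) ∘ₗ D.T₂.symm.toLinearMap :=
    TensorProduct.ext' fun a b => (hT₂ a b).symm
  refine ⟨ε, fun a b => ?_, fun a b => ?_⟩
  · exact (LinearMap.congr_fun hsliceL _).trans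
      (congrArg (LinearMap.mul' ℂ (A₀ n)) (D.T₁.symm_apply_apply _))
  · exact (LinearMap.congr_fun hsliceR _).trans
      (congrArg (LinearMap.mul' ℂ (A₀ n)) (D.T₂.symm_apply_apply _))

theorem isCounit_counit : D.IsCounit D.counit := by
  rw [counit, dif_pos D.exists_counit]
  exact D.exists_counit.choose_spec

theorem sliceL_counit_T₁ (t : A₀ n ⊗[ℂ] A₀ n) :
    sliceL D.counit (D.T₁ t) = LinearMap.mul' ℂ (A₀ n) t :=
  LinearMap.congr_fun (TensorProduct.ext' fun a b => D.isCounit_counit.1 a b :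
    sliceL D.counit ∘ₗ D.T₁.toLinearMap = LinearMap.mul' ℂ (A₀ n)) t

theorem sliceR_counit_T₂ (t : A₀ n ⊗[ℂ] A₀ n) :
    sliceR D.counit (D.T₂ t) = LinearMap.mul' ℂ (A₀ n) t :=
  LinearMap.congr_fun (TensorProduct.ext' fun a b => D.isCounit_counit.2 a b :
    sliceR D.counit ∘ₗ D.T₂.toLinearMap = LinearMap.mul' ℂ (A₀ n)) t

theorem counit_leftAct (f : finSuppDual n) (b : A₀ n) : D.counit (D.leftAct f b) = f.1 b := by
  obtain ⟨g, c, rfl⟩ := exists_eq_rightTranslate f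
  rw [leftAct_rightTranslate, ← apply_sliceL, sliceL_counit_T₁, LinearMap.mul'_apply,
    rightTranslate_apply]

theorem leftAct_eq_smul {f : finSuppDual n} {r : ℂ} (hf : f.1 = r • D.counit) (a : A₀ n) :
    D.leftAct f a = r • a := by
  refine eq_of_forall_mul_left fun p => ?_
  rw [mul_leftAct, hf, sliceR_smul, LinearMap.smul_apply, sliceR_counit_T₂, LinearMap.mul'_apply,
    mul_smul_comm]

theorem sliceL_counit_mulRightFst (p : A₀ n) (t : A₀ n ⊗[ℂ] A₀ n) :
    sliceL D.counit (mulRightFst p t) = D.counit p • sliceL D.counit t := by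
  obtain ⟨s, rfl⟩ := D.T₁.surjective t
  refine LinearMap.congr_fun (TensorProduct.ext' fun a q => ?_ :
    sliceL D.counit ∘ₗ mulRightFst p ∘ₗ D.T₁.toLinearMap
      = D.counit p • sliceL D.counit ∘ₗ D.T₁.toLinearMap) s
  change sliceL D.counit (mulRightFst p (D.T₁ (a ⊗ₜ q)))
    = D.counit p • sliceL D.counit (D.T₁ (a ⊗ₜ q))
  rw [mulRightFst_T₁, sliceL_counit_T₁, mul'_mulLeftFst, ← sliceL_counit_T₁,
    LinearEquiv.apply_symm_apply, sliceL_tmul, mul_smul_comm, sliceL_counit_T₁,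
    LinearMap.mul'_apply]

theorem counit_mul (a b : A₀ n) : D.counit (a * b) = D.counit a * D.counit b := by
  by_cases ha : a = 0
  · rw [ha, zero_mul, map_zero, zero_mul]
  have h := D.sliceL_counit_mulRightFst b (a ⊗ₜ a)
  rw [LinearMap.rTensor_tmul, sliceL_tmul, sliceL_tmul, smul_smul] at h
  rw [mul_comm (D.counit a)]
  exact smul_left_injective ℂ ha h

end Counit

section RightAntipode

/-- `m((id ⊗ S)((a ⊗ 1)Δ(b))) = ε(b)a`, the half of `IsAntipode` that determines `S`, for a linear
map `S` not yet known to be bijective. -/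
def IsRightAntipode (S : A₀ n →ₗ[ℂ] A₀ n) : Prop :=
  ∀ a b, LinearMap.mul' ℂ (A₀ n) (S.lTensor (A₀ n) (D.T₂ (a ⊗ₜ b))) = D.counit b • a

theorem isRightAntipode_iff {S : A₀ n →ₗ[ℂ] A₀ n} :
    D.IsRightAntipode S ↔ ∀ a b, a * S b = sliceR D.counit (D.T₂.symm (a ⊗ₜ b)) := by
  constructor
  · intro hS a b
    have h : LinearMap.mul' ℂ (A₀ n) ∘ₗ S.lTensor (A₀ n) ∘ₗ D.T₂.toLinearMap = sliceR D.counit :=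
      TensorProduct.ext' hS
    have hab := LinearMap.congr_fun h (D.T₂.symm (a ⊗ₜ b))
    simp only [LinearMap.comp_apply, LinearEquiv.coe_coe, LinearEquiv.apply_symm_apply] at hab
    exact hab
  · intro hS a b
    have h : LinearMap.mul' ℂ (A₀ n) ∘ₗ S.lTensor (A₀ n)
        = sliceR D.counit ∘ₗ D.T₂.symm.toLinearMap := TensorProduct.ext' hS
    have hab := LinearMap.congr_fun h (D.T₂ (a ⊗ₜ b))
    simp only [LinearMap.comp_apply, LinearEquiv.coe_coe, LinearEquiv.symm_apply_apply] at hab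
    exact hab

theorem sliceR_counit_T₂_symm_leftAct (f : finSuppDual n) (p b : A₀ n) :
    sliceR D.counit (D.T₂.symm (p ⊗ₜ D.leftAct f b)) = sliceR f.1 (D.T₂.symm (p ⊗ₜ b)) := by
  have h : D.T₂.symm (p ⊗ₜ D.leftAct f b)
      = (D.leftAct f).lTensor (A₀ n) (D.T₂.symm (p ⊗ₜ b)) := by
    rw [LinearEquiv.symm_apply_eq, T₂_lTensor_leftAct, LinearEquiv.apply_symm_apply,
      LinearMap.lTensor_tmul]
  rw [h, sliceR_lTensor]
  exact congrArg (sliceR · _) (LinearMap.ext (D.counit_leftAct f))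

namespace IsRightAntipode

variable {D} {S : A₀ n →ₗ[ℂ] A₀ n} (hS : D.IsRightAntipode S)

include hS

theorem rTensor_T₁ (p a b : A₀ n) :
    (LinearMap.mulLeft ℂ p ∘ₗ S).rTensor (A₀ n) (D.T₁ (a ⊗ₜ b))
      = mulRightSnd b (D.T₂.symm (p ⊗ₜ a)) := by
  refine eq_of_forall_sliceR fun f => ?_
  calc sliceR f ((LinearMap.mulLeft ℂ p ∘ₗ S).rTensor (A₀ n) (D.T₁ (a ⊗ₜ b)))
      = p * S (D.leftAct (rightTranslate f b) a) := by
        rw [sliceR_rTensor, leftAct_rightTranslate]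
        rfl
    _ = sliceR (rightTranslate f b).1 (D.T₂.symm (p ⊗ₜ a)) := by
        rw [D.isRightAntipode_iff.1 hS, sliceR_counit_T₂_symm_leftAct]
    _ = sliceR f (mulRightSnd b (D.T₂.symm (p ⊗ₜ a))) := (sliceR_lTensor f _ _).symm

theorem mul'_rTensor_T₁ (a b : A₀ n) :
    LinearMap.mul' ℂ (A₀ n) (S.rTensor (A₀ n) (D.T₁ (a ⊗ₜ b))) = D.counit a • b := by
  refine eq_of_forall_mul_left fun p => ?_
  calc p * LinearMap.mul' ℂ (A₀ n) (S.rTensor (A₀ n) (D.T₁ (a ⊗ₜ b)))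
      = LinearMap.mul' ℂ (A₀ n) (mulRightSnd b (D.T₂.symm (p ⊗ₜ a))) := by
        rw [← mul'_mulLeftFst, ← hS.rTensor_T₁, LinearMap.rTensor_comp_apply]
    _ = p * D.counit a • b := by
        rw [mul'_mulRightSnd, ← sliceR_counit_T₂, LinearEquiv.apply_symm_apply, sliceR_tmul,
          smul_mul_assoc, mul_smul_comm]

theorem mul'_rTensor (t : A₀ n ⊗[ℂ] A₀ n) :
    LinearMap.mul' ℂ (A₀ n) (S.rTensor (A₀ n) t) = sliceL D.counit (D.T₁.symm t) := by
  obtain ⟨s, rfl⟩ := D.T₁.surjective t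
  rw [LinearEquiv.symm_apply_apply]
  exact LinearMap.congr_fun (TensorProduct.ext' hS.mul'_rTensor_T₁ :
    LinearMap.mul' ℂ (A₀ n) ∘ₗ S.rTensor (A₀ n) ∘ₗ D.T₁.toLinearMap = sliceL D.counit) s

theorem mul'_rTensor_mulRightFst (b : A₀ n) (t : A₀ n ⊗[ℂ] A₀ n) :
    LinearMap.mul' ℂ (A₀ n) (S.rTensor (A₀ n) (mulRightFst b t))
      = S b * LinearMap.mul' ℂ (A₀ n) (S.rTensor (A₀ n) t) := by
  obtain ⟨s, rfl⟩ := D.T₁.surjective t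
  refine LinearMap.congr_fun (TensorProduct.ext' fun a q => ?_ :
    LinearMap.mul' ℂ (A₀ n) ∘ₗ S.rTensor (A₀ n) ∘ₗ mulRightFst b ∘ₗ D.T₁.toLinearMap
      = LinearMap.mulLeft ℂ (S b) ∘ₗ LinearMap.mul' ℂ (A₀ n) ∘ₗ S.rTensor (A₀ n)
        ∘ₗ D.T₁.toLinearMap) s
  change LinearMap.mul' ℂ (A₀ n) (S.rTensor (A₀ n) (mulRightFst b (D.T₁ (a ⊗ₜ q))))
    = S b * LinearMap.mul' ℂ (A₀ n) (S.rTensor (A₀ n) (D.T₁ (a ⊗ₜ q)))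
  have hcounit (u : A₀ n ⊗[ℂ] A₀ n) :
      sliceL D.counit (mulLeftFst a u) = D.counit a • sliceL D.counit u :=
    LinearMap.congr_fun (TensorProduct.ext' fun x y => by
      simp [counit_mul, smul_smul] :
      sliceL D.counit ∘ₗ mulLeftFst a = D.counit a • sliceL D.counit) u
  rw [mulRightFst_T₁, hS.mul'_rTensor, LinearEquiv.symm_apply_apply, hcounit, ← hS.mul'_rTensor,
    hS.mul'_rTensor_T₁, LinearMap.rTensor_tmul, LinearMap.mul'_apply, mul_smul_comm]

theorem apply_mul (a b : A₀ n) : S (a * b) = S b * S a :=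
  eq_of_forall_mul_right fun c =>
    (hS.mul'_rTensor_mulRightFst b (a ⊗ₜ c)).trans (mul_assoc _ _ _).symm

end IsRightAntipode

end RightAntipode

namespace IsLeftHaar

variable {D} {φ : A₀ n →ₗ[ℂ] ℂ} (hφ : D.IsLeftHaar φ)

include hφ

theorem apply_star (a : A₀ n) : φ (star a) = star (φ a) := apply_star_of_nonneg hφ.positive a

theorem eq_of_forall_mul_left {a b : A₀ n} (h : ∀ x, φ (x * a) = φ (x * b)) : a = b := by
  refine sub_eq_zero.1 (hφ.faithful _ ?_)
  rw [mul_sub, map_sub, h, sub_self]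

theorem eq_of_forall_mul_right {a b : A₀ n} (h : ∀ x, φ (a * x) = φ (b * x)) : a = b := by
  refine star_injective (hφ.eq_of_forall_mul_left fun x => ?_)
  have hstar (c : A₀ n) : φ (x * star c) = star (φ (c * star x)) := by
    rw [← hφ.apply_star, star_mul, star_star]
  rw [hstar, hstar, h]

theorem sliceR_T₂ (t : A₀ n ⊗[ℂ] A₀ n) : sliceR φ (D.T₂ t) = sliceR φ t :=
  LinearMap.congr_fun (TensorProduct.ext' fun b a => hφ.left_invariant a b :
    sliceR φ ∘ₗ D.T₂.toLinearMap = sliceR φ) t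

@[elab_as_elim] theorem induction_leftAct {p : A₀ n → Prop}
    (leftAct : ∀ a c, p (D.leftAct (rightTranslate φ c) a))
    (add : ∀ x y, p x → p y → p (x + y)) (x : A₀ n) : p x := by
  have hslice (t : A₀ n ⊗[ℂ] A₀ n) : p (sliceR φ (D.T₁ t)) := by
    induction t with
    | zero =>
      rw [map_zero, map_zero, ← (D.leftAct (rightTranslate φ 0)).map_zero]
      exact leftAct 0 0
    | add x y hx hy =>
      rw [map_add, map_add]
      exact add _ _ hx hy
    | tmul a c =>
      rw [← leftAct_rightTranslate]
      exact leftAct a c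
  by_cases hx : x = 0
  · have h := hslice 0
    rwa [map_zero, map_zero, ← hx] at h
  have hne : φ (star x * x) ≠ 0 := fun h => hx (hφ.faithful x h)
  have h := hslice (D.T₁.symm (x ⊗ₜ ((φ (star x * x))⁻¹ • (star x * x))))
  rwa [LinearEquiv.apply_symm_apply, sliceR_tmul, map_smul, smul_eq_mul, inv_mul_cancel₀ hne,
    one_smul] at h

theorem linearMap_ext {V : Type*} [AddCommMonoid V] [Module ℂ V] {g h : A₀ n →ₗ[ℂ] V}
    (hgh : ∀ a c, g (D.leftAct (rightTranslate φ c) a) = h (D.leftAct (rightTranslate φ c) a)) :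
    g = h :=
  LinearMap.ext <| hφ.induction_leftAct hgh fun x y hx hy => by rw [map_add, map_add, hx, hy]

/-- Strong left invariance: it forces `S((id ⊗ φ)(Δ(a)(1 ⊗ c))) = (id ⊗ φ)((1 ⊗ a)Δ(c))`. -/
theorem sliceR_counit_T₂_symm_leftAct_rightTranslate (p a c : A₀ n) :
    sliceR D.counit (D.T₂.symm (p ⊗ₜ D.leftAct (rightTranslate φ c) a))
      = p * D.leftAct (leftTranslate φ a) c := by
  calc sliceR D.counit (D.T₂.symm (p ⊗ₜ D.leftAct (rightTranslate φ c) a))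
      = sliceR φ (mulRightSnd c (D.T₂.symm (p ⊗ₜ a))) := by
        rw [sliceR_counit_T₂_symm_leftAct, sliceR_lTensor]
        rfl
    _ = sliceR φ (mulLeftSnd a (D.T₂ (p ⊗ₜ c))) := by rw [← hφ.sliceR_T₂, ← mulLeftSnd_T₂]
    _ = p * D.leftAct (leftTranslate φ a) c := by
        rw [sliceR_lTensor, mul_leftAct]
        rfl

theorem exists_isRightAntipode : ∃ S, D.IsRightAntipode S := by
  have h (x : A₀ n) : ∃ s, ∀ p, p * s = sliceR D.counit (D.T₂.symm (p ⊗ₜ x)) := by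
    refine hφ.induction_leftAct (fun a c => ⟨D.leftAct (leftTranslate φ a) c, fun p => ?_⟩)
      (fun x y ⟨s, hs⟩ ⟨t, ht⟩ => ⟨s + t, fun p => ?_⟩) x
    · rw [hφ.sliceR_counit_T₂_symm_leftAct_rightTranslate]
    · rw [mul_add, hs, ht, TensorProduct.tmul_add, map_add, map_add]
  choose S hS using h
  refine ⟨⟨⟨S, fun x y => DQG.eq_of_forall_mul_left fun p => ?_⟩,
    fun r x => DQG.eq_of_forall_mul_left fun p => ?_⟩, D.isRightAntipode_iff.2 fun p x => hS x p⟩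
  · rw [mul_add, hS, hS, hS, TensorProduct.tmul_add, map_add, map_add]
  · change p * S (r • x) = p * (r • S x)
    rw [mul_smul_comm, hS, hS, TensorProduct.tmul_smul, map_smul, map_smul]

theorem conjFinSuppDual_rightTranslate (a : A₀ n) :
    conjFinSuppDual (rightTranslate φ a) = leftTranslate φ (star a) :=
  Subtype.ext <| LinearMap.ext fun x => by
    rw [conjFinSuppDual_apply, rightTranslate_apply, leftTranslate_apply, ← hφ.apply_star,
      star_mul, star_star]

theorem conjFinSuppDual_leftTranslate (a : A₀ n) :
    conjFinSuppDual (leftTranslate φ a) = rightTranslate φ (star a) :=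
  Subtype.ext <| LinearMap.ext fun x => by
    rw [conjFinSuppDual_apply, rightTranslate_apply, leftTranslate_apply, ← hφ.apply_star,
      star_mul, star_star]

end IsLeftHaar

namespace IsRightAntipode

variable {D} {S : A₀ n →ₗ[ℂ] A₀ n} (hS : D.IsRightAntipode S) {φ : A₀ n →ₗ[ℂ] ℂ}
  (hφ : D.IsLeftHaar φ)

include hS hφ

theorem apply_leftAct (a c : A₀ n) :
    S (D.leftAct (rightTranslate φ c) a) = D.leftAct (leftTranslate φ a) c :=
  eq_of_forall_mul_left fun p => by
    rw [D.isRightAntipode_iff.1 hS, hφ.sliceR_counit_T₂_symm_leftAct_rightTranslate]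

theorem apply_star_apply (x : A₀ n) : S (star (S x)) = star x := by
  refine hφ.induction_leftAct (fun a c => ?_) (fun x y hx hy => ?_) x
  · rw [hS.apply_leftAct hφ, star_leftAct, hφ.conjFinSuppDual_leftTranslate, hS.apply_leftAct hφ,
      star_leftAct, hφ.conjFinSuppDual_rightTranslate]
  · rw [map_add, star_add, map_add, hx, hy, star_add]

theorem bijective : Function.Bijective S := by
  refine ⟨fun x y h => ?_, fun x => ⟨star (S (star x)), ?_⟩⟩
  · rw [← star_star x, ← star_star y, ← hS.apply_star_apply hφ x, ← hS.apply_star_apply hφ y, h]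
  · rw [hS.apply_star_apply hφ, star_star]

end IsRightAntipode

theorem isRightAntipode_antipode (h : ∃ S, D.IsAntipode S) :
    D.IsRightAntipode D.antipode.toLinearMap := by
  rw [antipode, dif_pos h]
  exact h.choose_spec.2

theorem comp_antipode_mem_finSuppDual (f : finSuppDual n) :
    f.1 ∘ₗ D.antipode.toLinearMap ∈ finSuppDual n := by
  by_cases hexists : ∃ S, D.IsAntipode S
  · obtain ⟨g, e, rfl⟩ := exists_eq_leftTranslate f
    convert (rightTranslate (g ∘ₗ D.antipode.toLinearMap) (D.antipode.symm e)).2 using 1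
    refine LinearMap.ext fun x => ?_
    have h := (D.isRightAntipode_antipode hexists).apply_mul x (D.antipode.symm e)
    simp only [LinearEquiv.coe_coe, LinearEquiv.apply_symm_apply] at h
    exact congrArg g h.symm
  · rw [antipode, dif_neg hexists]
    exact f.2

/-- The antipode `f ↦ f ∘ S` of the convolution algebra `A₀'`. -/
def dualAntipode (f : finSuppDual n) : finSuppDual n :=
  ⟨f.1 ∘ₗ D.antipode.toLinearMap, D.comp_antipode_mem_finSuppDual f⟩

@[simp] theorem dualAntipode_apply (f : finSuppDual n) (x : A₀ n) :
    (D.dualAntipode f).1 x = f.1 (D.antipode x) := rfl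

namespace IsLeftHaar

variable {D} {φ : A₀ n →ₗ[ℂ] ℂ} (hφ : D.IsLeftHaar φ)

include hφ

theorem exists_antipode : ∃ S : A₀ n ≃ₗ[ℂ] A₀ n, D.IsAntipode S := by
  obtain ⟨S, hS⟩ := hφ.exists_isRightAntipode
  exact ⟨LinearEquiv.ofBijective S (hS.bijective hφ), hS.mul'_rTensor_T₁, hS⟩

theorem antipode_mul (a b : A₀ n) : D.antipode (a * b) = D.antipode b * D.antipode a :=
  (D.isRightAntipode_antipode hφ.exists_antipode).apply_mul a b

theorem antipode_leftAct (a c : A₀ n) :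
    D.antipode (D.leftAct (rightTranslate φ c) a) = D.leftAct (leftTranslate φ a) c :=
  (D.isRightAntipode_antipode hφ.exists_antipode).apply_leftAct hφ a c

theorem antipode_star_antipode (x : A₀ n) : D.antipode (star (D.antipode x)) = star x :=
  (D.isRightAntipode_antipode hφ.exists_antipode).apply_star_apply hφ x

theorem antipode_symm_mul (a b : A₀ n) :
    D.antipode.symm (a * b) = D.antipode.symm b * D.antipode.symm a := by
  rw [LinearEquiv.symm_apply_eq, hφ.antipode_mul, LinearEquiv.apply_symm_apply,
    LinearEquiv.apply_symm_apply]

theorem antipode_symm_eq (x : A₀ n) : D.antipode.symm x = star (D.antipode (star x)) := by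
  rw [LinearEquiv.symm_apply_eq, hφ.antipode_star_antipode, star_star]

theorem antipode_rightAct_dualAntipode (f : finSuppDual n) (b : A₀ n) :
    D.antipode (D.rightAct (D.dualAntipode f) b) = D.leftAct f (D.antipode b) := by
  refine LinearMap.congr_fun (hφ.linearMap_ext fun a c => ?_ :
    D.antipode.toLinearMap ∘ₗ D.rightAct (D.dualAntipode f)
      = D.leftAct f ∘ₗ D.antipode.toLinearMap) b
  change D.antipode (D.rightAct (D.dualAntipode f) (D.leftAct _ a))
    = D.leftAct f (D.antipode (D.leftAct _ a))
  rw [rightAct_leftAct, hφ.antipode_leftAct, hφ.antipode_leftAct]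
  refine eq_of_forall_finSuppDual fun g => ?_
  calc g.1 (D.leftAct (leftTranslate φ (D.rightAct (D.dualAntipode f) a)) c)
      = (D.dualAntipode f).1 (D.leftAct (rightTranslate φ (D.rightAct g c)) a) := by
        rw [apply_leftAct, ← apply_rightAct, leftTranslate_apply, ← rightTranslate_apply,
          apply_rightAct, apply_leftAct]
    _ = f.1 (D.leftAct (leftTranslate φ a) (D.rightAct g c)) := by
        rw [dualAntipode_apply, hφ.antipode_leftAct]
    _ = g.1 (D.leftAct f (D.leftAct (leftTranslate φ a) c)) := by
        rw [← rightAct_leftAct, apply_rightAct, apply_leftAct]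

theorem conv_dualAntipode (f g : finSuppDual n) (x : A₀ n) :
    D.conv (D.dualAntipode f) (D.dualAntipode g) x = D.conv g f (D.antipode x) := by
  rw [← apply_rightAct, dualAntipode_apply, hφ.antipode_rightAct_dualAntipode, apply_leftAct]

end IsLeftHaar

section Cointegral

theorem counit_ne_zero [Nontrivial (A₀ n)] : D.counit ≠ 0 := by
  intro h
  obtain ⟨a, ha⟩ := exists_ne (0 : A₀ n)
  refine ha (eq_of_forall_finSuppDual fun f => ?_)
  rw [← D.counit_leftAct, h, LinearMap.zero_apply, map_zero]

theorem exists_counit_single_one_ne_zero [Nontrivial (A₀ n)] :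
    ∃ α, D.counit (single α 1) ≠ 0 := by
  by_contra! h
  refine D.counit_ne_zero (linearMap_ext_single fun α M => ?_)
  rw [← one_mul M, ← single_apply_same (n := n) α 1, ← mul_single, counit_mul, h, zero_mul,
    LinearMap.zero_apply]

theorem exists_algHom_counit_single {α : I} (hα : D.counit (single α 1) ≠ 0) :
    ∃ χ : Matrix (Fin (n α)) (Fin (n α)) ℂ →ₐ[ℂ] ℂ, ∀ M, χ M = D.counit (single α M) := by
  have hmul (M N : Matrix (Fin (n α)) (Fin (n α)) ℂ) :
      D.counit (single α (M * N)) = D.counit (single α M) * D.counit (single α N) := by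
    rw [← counit_mul, mul_single, single_apply_same]
  have hone : D.counit (single α 1) = 1 := by
    have h := hmul 1 1
    rw [mul_one] at h
    exact (mul_eq_left₀ hα).1 h.symm
  exact ⟨AlgHom.ofLinearMap (D.counit ∘ₗ singleₗ n α) hone hmul, fun M => rfl⟩

/-- Some block supports a character of `A₀`; a simple algebra with a character is `ℂ`, so the unit
of that block is a two-sided cointegral. -/
theorem exists_cointegral [Nontrivial (A₀ n)] :
    ∃ h : A₀ n, D.counit h = 1 ∧ ∀ x, x * h = D.counit x • h ∧ h * x = D.counit x • h := by
  obtain ⟨α, hα⟩ := D.exists_counit_single_one_ne_zero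
  obtain ⟨χ, hχ⟩ := D.exists_algHom_counit_single hα
  have : Nonempty (Fin (n α)) := ⟨⟨0, D.n_pos α⟩⟩
  have hχ_injective : Function.Injective χ := χ.toRingHom.injective
  have hcounit_one : D.counit (single α 1) = 1 := by rw [← hχ, map_one]
  have hscalar (x : A₀ n) : (x : Malg n) α = D.counit x • 1 := by
    refine hχ_injective ?_
    rw [hχ, map_smul, map_one, smul_eq_mul, mul_one, ← mul_one ((x : Malg n) α), ← mul_single,
      counit_mul, hcounit_one, mul_one]
  refine ⟨single α 1, hcounit_one, fun x => ⟨?_, ?_⟩⟩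
  · rw [mul_single, hscalar, mul_one]
    exact map_smul (singleₗ n α) _ _
  · rw [single_mul, hscalar, one_mul]
    exact map_smul (singleₗ n α) _ _

end Cointegral

namespace IsLeftHaar

variable {D} {φ : A₀ n →ₗ[ℂ] ℂ} (hφ : D.IsLeftHaar φ)

include hφ

theorem apply_cointegral_ne_zero {h : A₀ n} (hcounit : D.counit h = 1)
    (hmul : ∀ x, x * h = D.counit x • h) : φ h ≠ 0 := by
  intro hzero
  have : h = 0 := hφ.faithful h (by rw [hmul, map_smul, hzero, smul_zero])
  rw [this, map_zero] at hcounit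
  exact zero_ne_one hcounit

/-- Strong left invariance is applied to a cointegral `h`, for which both `φ(h ·)` and `φ(· h)` are
multiples of the counit. -/
theorem apply_mul_antipode_antipode (a b : A₀ n) :
    φ (b * D.antipode (D.antipode a)) = φ (a * b) := by
  by_cases ha : a = 0
  · rw [ha, map_zero, map_zero, mul_zero, zero_mul]
  have : Nontrivial (A₀ n) := ⟨a, 0, ha⟩
  obtain ⟨h, hcounit, hmul⟩ := D.exists_cointegral
  have hright (x : A₀ n) : D.leftAct (rightTranslate φ h) x = φ h • x :=
    D.leftAct_eq_smul (LinearMap.ext fun y => by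
      rw [rightTranslate_apply, (hmul y).1, map_smul, LinearMap.smul_apply, smul_eq_mul,
        smul_eq_mul, mul_comm]) x
  have hleft (x : A₀ n) : D.leftAct (leftTranslate φ h) x = φ h • x :=
    D.leftAct_eq_smul (LinearMap.ext fun y => by
      rw [leftTranslate_apply, (hmul y).2, map_smul, LinearMap.smul_apply, smul_eq_mul,
        smul_eq_mul, mul_comm]) x
  have hrecover : D.rightAct (D.dualAntipode (leftTranslate φ b)) h = φ h • b :=
    hφ.eq_of_forall_mul_right fun c => by
      rw [← rightTranslate_apply, apply_rightAct, ← apply_leftAct, dualAntipode_apply,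
        leftTranslate_apply, hφ.antipode_leftAct, hleft, mul_smul_comm, smul_mul_assoc]
  refine mul_left_cancel₀ (hφ.apply_cointegral_ne_zero hcounit fun x => (hmul x).1) ?_
  calc φ h * φ (b * D.antipode (D.antipode a))
      = φ (b * D.antipode (D.antipode (D.leftAct (rightTranslate φ h) a))) := by
        rw [hright, map_smul, map_smul, mul_smul_comm, map_smul, smul_eq_mul]
    _ = φ (a * D.rightAct (D.dualAntipode (leftTranslate φ b)) h) := by
        rw [hφ.antipode_leftAct, ← leftTranslate_apply, ← dualAntipode_apply, apply_leftAct,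
          ← apply_rightAct, leftTranslate_apply]
    _ = φ h * φ (a * b) := by rw [hrecover, mul_smul_comm, map_smul, smul_eq_mul]

theorem apply_antipode_antipode (a : A₀ n) : φ (D.antipode (D.antipode a)) = φ a := by
  obtain ⟨e, -, ⟨he, -⟩, -, ha⟩ := exists_localUnit (D.antipode (D.antipode a)) a
  rw [← he, hφ.apply_mul_antipode_antipode, ha]

theorem apply_antipode_symm (a : A₀ n) : φ (D.antipode.symm a) = φ (D.antipode a) := by
  rw [← hφ.apply_antipode_antipode, LinearEquiv.apply_symm_apply]

end IsLeftHaar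

section Modular

namespace IsModularRoot

variable {D} {φ : A₀ n →ₗ[ℂ] ℂ} {θ : Malg n} (hθ : D.IsModularRoot φ θ)

include hθ

theorem isSelfAdjoint_mul_self : IsSelfAdjoint (θ * θ) := by
  rw [IsSelfAdjoint, star_mul, show star θ = θ from funext fun α => (hθ.posDef α).1]

theorem inv_mul_inv_mul_cancel :
    (fun α => (θ α)⁻¹ * (θ α)⁻¹ : Malg n) * (θ * θ) = 1 ∧
      θ * θ * (fun α => (θ α)⁻¹ * (θ α)⁻¹ : Malg n) = 1 := by
  have hdet (α : I) : IsUnit (θ α).det := (Matrix.isUnit_iff_isUnit_det _).1 (hθ.posDef α).isUnit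
  constructor <;> funext α
  · change (θ α)⁻¹ * (θ α)⁻¹ * (θ α * θ α) = 1
    rw [mul_assoc, Matrix.nonsing_inv_mul_cancel_left _ _ (hdet α),
      Matrix.nonsing_inv_mul _ (hdet α)]
  · change θ α * θ α * ((θ α)⁻¹ * (θ α)⁻¹) = 1
    rw [mul_assoc, Matrix.mul_nonsing_inv_cancel_left _ _ (hdet α),
      Matrix.mul_nonsing_inv _ (hdet α)]

theorem rightHaar_apply (a : A₀ n) : rightHaar φ θ a = φ (D.antipode a) := (hθ.modular a).symm

end IsModularRoot

namespace IsLeftHaar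

variable {D} {φ : A₀ n →ₗ[ℂ] ℂ} (hφ : D.IsLeftHaar φ) {θ : Malg n} (hθ : D.IsModularRoot φ θ)

include hφ hθ

theorem apply_multLeft_eq (a : A₀ n) : φ (multLeft (θ * θ) a) = φ (D.antipode.symm a) := by
  rw [hφ.antipode_symm_eq, hφ.apply_star, hθ.modular, ← hφ.apply_star, star_multRight,
    hθ.isSelfAdjoint_mul_self.star_eq, star_star]

theorem apply_multLeft_eq_apply_multRight (a : A₀ n) :
    φ (multLeft (θ * θ) a) = φ (multRight (θ * θ) a) := by
  rw [hφ.apply_multLeft_eq hθ, hφ.apply_antipode_symm, hθ.modular]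

/-- `S(θ²) = θ⁻²`, expressed inside `A₀`. -/
theorem multLeft_antipode_multRight (z : A₀ n) :
    multLeft (θ * θ) (D.antipode (multRight (θ * θ) z)) = D.antipode z := by
  refine hφ.eq_of_forall_mul_right fun x => ?_
  rw [← multLeft_mul, hφ.apply_multLeft_eq hθ, hφ.antipode_symm_mul,
    LinearEquiv.symm_apply_apply, ← multRight_mul, ← hθ.modular, hφ.antipode_mul,
    LinearEquiv.apply_symm_apply]

theorem antipode_sharp (a : A₀ n) :
    D.antipode (D.sharp θ a) = multRight (θ * θ) (star a) := by
  obtain ⟨hinv_mul, hmul_inv⟩ := hθ.inv_mul_inv_mul_cancel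
  refine DQG.eq_of_forall_mul_right fun x => ?_
  obtain ⟨y, rfl⟩ := D.antipode.surjective x
  obtain ⟨z, rfl⟩ : ∃ z, multRight (θ * θ) z = y :=
    ⟨_, multRight_multRight_of_mul_eq_one hinv_mul y⟩
  calc D.antipode (D.sharp θ a) * D.antipode (multRight (θ * θ) z)
      = D.antipode (z * D.antipode.symm (star a)) := by
        rw [← hφ.antipode_mul, ← mul_multLeft, sharp, multLeft_multLeft_of_mul_eq_one hmul_inv]
    _ = star a * multLeft (θ * θ) (D.antipode (multRight (θ * θ) z)) := by
        rw [hφ.antipode_mul, LinearEquiv.apply_symm_apply, hφ.multLeft_antipode_multRight hθ]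
    _ = multRight (θ * θ) (star a) * D.antipode (multRight (θ * θ) z) := mul_multLeft _ _ _

end IsLeftHaar

end Modular

section DualStarAlgebra

theorem comp_leftAct_mem_finSuppDual (f g : finSuppDual n) :
    f.1 ∘ₗ D.leftAct g ∈ finSuppDual n := by
  obtain ⟨f, p, rfl⟩ := exists_eq_rightTranslate f
  obtain ⟨g, q, rfl⟩ := exists_eq_rightTranslate g
  refine mem_finSuppDual_of_mulLeftFst (f ∘ₗ sliceR g ∘ₗ D.T₁.toLinearMap)
    (D.T₁.symm (p ⊗ₜ q)) fun x => ?_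
  change f (D.leftAct (rightTranslate g q) x * p) = f (sliceR g (D.T₁ _))
  rw [← mulRightFst_T₁, sliceR_rTensor, leftAct_rightTranslate, LinearMap.mulRight_apply]

/-- The convolution product `f ∗ g` of `A₀'`, with values `D.conv f g x`. -/
def convolution (f g : finSuppDual n) : finSuppDual n :=
  ⟨f.1 ∘ₗ D.leftAct g, D.comp_leftAct_mem_finSuppDual f g⟩

theorem convolution_apply (f g : finSuppDual n) (x : A₀ n) :
    (D.convolution f g).1 x = D.conv f g x := D.apply_leftAct f g x

/-- The involution `f ↦ f*` of `A₀'`, with values `D.adjoint f x`. -/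
def dualStar (f : finSuppDual n) : finSuppDual n := D.dualAntipode (conjFinSuppDual f)

theorem dualStar_apply (f : finSuppDual n) (x : A₀ n) : (D.dualStar f).1 x = D.adjoint f x := rfl

theorem convolution_assoc (f g h : finSuppDual n) :
    D.convolution (D.convolution f g) h = D.convolution f (D.convolution g h) :=
  Subtype.ext <| LinearMap.ext fun x => by
    rw [convolution_apply, convolution_apply, ← apply_leftAct, ← apply_rightAct,
      convolution_apply, convolution_apply, ← apply_rightAct, ← apply_leftAct, rightAct_leftAct]

namespace IsLeftHaar

variable {D} {φ : A₀ n →ₗ[ℂ] ℂ} (hφ : D.IsLeftHaar φ)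

include hφ

theorem dualStar_convolution (f g : finSuppDual n) :
    D.dualStar (D.convolution f g) = D.convolution (D.dualStar g) (D.dualStar f) :=
  Subtype.ext <| LinearMap.ext fun x => by
    rw [dualStar_apply, adjoint, convolution_apply, conv_star, star_star, convolution_apply,
      dualStar, dualStar, hφ.conv_dualAntipode]

theorem dualStar_dualStar (f : finSuppDual n) : D.dualStar (D.dualStar f) = f :=
  Subtype.ext <| LinearMap.ext fun x => by
    rw [dualStar_apply, adjoint, dualStar_apply, adjoint, star_star, hφ.antipode_star_antipode,
      star_star]

theorem isComplexStarAlgebra_dual :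
    IsComplexStarAlgebra D.convolution D.dualStar where
  add_mul _ _ _ := rfl
  mul_add f g h := Subtype.ext <| LinearMap.ext fun x => by
    simp only [convolution_apply, ← apply_rightAct, Submodule.coe_add, LinearMap.add_apply]
  smul_mul _ _ _ := rfl
  mul_smul r f g := Subtype.ext <| LinearMap.ext fun x => by
    simp only [convolution_apply, ← apply_rightAct, Submodule.coe_smul, LinearMap.smul_apply]
  mul_assoc := D.convolution_assoc
  inv_add f g := Subtype.ext <| LinearMap.ext fun x => star_add (f.1 _) (g.1 _)
  inv_smul r f := Subtype.ext <| LinearMap.ext fun x => star_smul r (f.1 _)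
  inv_mul := hφ.dualStar_convolution
  inv_inv := hφ.dualStar_dualStar

end IsLeftHaar

end DualStarAlgebra

section Fourier

theorem prod'_eq_rightAct (φ : A₀ n →ₗ[ℂ] ℂ) (a b : A₀ n) :
    D.prod' φ a b = D.rightAct (D.dualAntipode (leftTranslate φ a)) b :=
  congrArg (fun F => evalMult F (D.comul b)) (TensorProduct.ext' fun _ _ => rfl)

namespace IsLeftHaar

variable {D} {φ ψ : A₀ n →ₗ[ℂ] ℂ} (hφ : D.IsLeftHaar φ) (hψ : ∀ x, ψ x = φ (D.antipode x))

include hφ hψ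

theorem prod_eq_leftAct (a b : A₀ n) :
    D.prod ψ a b = D.leftAct (rightTranslate φ (D.antipode b)) a := by
  refine congrArg (fun F => evalMult F (D.comul a)) (TensorProduct.ext' fun x y => ?_)
  change ψ (b * D.antipode.symm y) • x = φ (y * D.antipode b) • x
  rw [hψ, hφ.antipode_mul, LinearEquiv.apply_symm_apply]

theorem prod_eq_prod' (a b : A₀ n) : D.prod ψ a b = D.prod' φ a b :=
  D.antipode.injective <| by
    rw [hφ.prod_eq_leftAct hψ, hφ.antipode_leftAct, prod'_eq_rightAct,
      hφ.antipode_rightAct_dualAntipode]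

theorem dualAntipode_rightTranslate_antipode (a : A₀ n) :
    D.dualAntipode (rightTranslate φ (D.antipode a)) = leftTranslate ψ a :=
  Subtype.ext <| LinearMap.ext fun x => by
    rw [dualAntipode_apply, rightTranslate_apply, leftTranslate_apply, hψ, hφ.antipode_mul]

theorem dualAntipode_leftTranslate_antipode (a : A₀ n) :
    D.dualAntipode (leftTranslate φ (D.antipode a)) = rightTranslate ψ a :=
  Subtype.ext <| LinearMap.ext fun x => by
    rw [dualAntipode_apply, rightTranslate_apply, leftTranslate_apply, hψ, hφ.antipode_mul]

theorem antipode_rightAct_leftTranslate (a x : A₀ n) :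
    D.antipode (D.rightAct (leftTranslate ψ a) x) = D.rightAct (rightTranslate ψ x) a :=
  D.antipode.injective <| by
    rw [← hφ.dualAntipode_rightTranslate_antipode hψ, hφ.antipode_rightAct_dualAntipode,
      hφ.antipode_leftAct, ← hφ.dualAntipode_leftTranslate_antipode hψ,
      hφ.antipode_rightAct_dualAntipode]

theorem convolution_leftTranslate (a b : A₀ n) :
    D.convolution (leftTranslate ψ a) (leftTranslate ψ b) = leftTranslate ψ (D.prod ψ a b) :=
  Subtype.ext <| LinearMap.ext fun x => by
    calc (D.convolution (leftTranslate ψ a) (leftTranslate ψ b)).1 x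
        = φ (D.rightAct (rightTranslate ψ x) a * D.antipode b) := by
          rw [convolution_apply, ← apply_rightAct, leftTranslate_apply, hψ, hφ.antipode_mul,
            hφ.antipode_rightAct_leftTranslate hψ]
      _ = ψ (D.leftAct (rightTranslate φ (D.antipode b)) a * x) := by
          rw [← rightTranslate_apply, apply_rightAct, ← apply_leftAct, rightTranslate_apply]
      _ = (leftTranslate ψ (D.prod ψ a b)).1 x := by
          rw [hφ.prod_eq_leftAct hψ, leftTranslate_apply]

theorem dualStar_leftTranslate {θ : Malg n} (hθ : D.IsModularRoot φ θ) (a : A₀ n) :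
    D.dualStar (leftTranslate ψ a) = leftTranslate ψ (D.sharp θ a) :=
  Subtype.ext <| LinearMap.ext fun x => by
    calc (D.dualStar (leftTranslate ψ a)).1 x
        = φ (multLeft (θ * θ) (D.antipode x * star a)) := by
          rw [dualStar_apply, adjoint, leftTranslate_apply, hψ, hθ.modular, ← hφ.apply_star,
            star_multRight, hθ.isSelfAdjoint_mul_self.star_eq, star_mul, star_star]
      _ = φ (D.antipode x * D.antipode (D.sharp θ a)) := by
          rw [hφ.apply_multLeft_eq_apply_multRight hθ, multRight_mul, hφ.antipode_sharp hθ]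
      _ = (leftTranslate ψ (D.sharp θ a)).1 x := by
          rw [leftTranslate_apply, hψ, hφ.antipode_mul]

theorem leftTranslate_injective : Function.Injective (leftTranslate ψ) := by
  refine fun a b h => D.antipode.injective (hφ.eq_of_forall_mul_left fun x => ?_)
  obtain ⟨y, rfl⟩ := D.antipode.surjective x
  rw [← hφ.antipode_mul, ← hφ.antipode_mul, ← hψ, ← hψ]
  exact LinearMap.congr_fun (congrArg Subtype.val h) y

theorem isComplexStarAlgebra {θ : Malg n} (hθ : D.IsModularRoot φ θ) :
    IsComplexStarAlgebra (D.prod ψ) (D.sharp θ) :=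
  hφ.isComplexStarAlgebra_dual.of_injective (leftTranslateₗ ψ) (hφ.leftTranslate_injective hψ)
    (fun a b => (hφ.convolution_leftTranslate hψ a b).symm)
    fun a => (hφ.dualStar_leftTranslate hψ hθ a).symm

end IsLeftHaar

end Fourier

end DiscreteQuantumGroup

end

theorem mainTheorem6 {I : Type*} {n : I → ℕ} (D : DiscreteQuantumGroup I n)
    (φ : A₀ n →ₗ[ℂ] ℂ) (hφ : D.IsLeftHaar φ)
    (θ : Malg n) (hθ : D.IsModularRoot φ θ)
    (ψ : A₀ n →ₗ[ℂ] ℂ) (hψ : ψ = DiscreteQuantumGroup.rightHaar φ θ) :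
    (∀ a b : A₀ n, D.prod ψ a b = D.prod' φ a b) ∧
    (∀ a b x : A₀ n,
      D.conv (leftTranslate ψ a) (leftTranslate ψ b) x = (leftTranslate ψ (D.prod ψ a b)).1 x) ∧
    (∀ a x : A₀ n, D.adjoint (leftTranslate ψ a) x = (leftTranslate ψ (D.sharp θ a)).1 x) ∧
    Function.Injective (leftTranslate ψ) ∧
    IsComplexStarAlgebra (D.prod ψ) (D.sharp θ) := by
  have hψ_apply (x : A₀ n) : ψ x = φ (D.antipode x) := by rw [hψ, hθ.rightHaar_apply]
  refine ⟨hφ.prod_eq_prod' hψ_apply, fun a b x => ?_, fun a x => ?_,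
    hφ.leftTranslate_injective hψ_apply, hφ.isComplexStarAlgebra hψ_apply hθ⟩
  · rw [← hφ.convolution_leftTranslate hψ_apply, D.convolution_apply]
  · rw [← hφ.dualStar_leftTranslate hψ_apply hθ, D.dualStar_apply]
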